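/- Let $1\le p\le\infty$, let $\Omega\subset\mathbb{R}^n$ be open, let $A:L^p(\Omega)\to L^p(\Omega)$ be a bounded linear operator, let $u_0\in L^p(\Omega)$ ($L^p(\Omega)$ being real-valued), and let $\alpha\in L^\infty(\Omega)$ satisfy $\alpha(x)\in[\alpha_0,1]$ for almost every $x\in\Omega$, for some $\alpha_0\in(0,1)$. Let $f:[0,\infty)\times L^p(\Omega)\to L^p(\Omega)$ be continuous, and assume that $f$ is locally Lipschitz in the second variable, uniformly with respect to the first: for every $(t_0,\phi_0)\in[0,\infty)\times L^p(\Omega)$ there are $r_0,L_0>0$ such that $\|f(t,\psi)-f(t,\phi)\|_{L^p(\Omega)}\le L_0\|\psi-\phi\|_{L^p(\Omega)}$ whenever $t\ge 0$, $|t-t_0|+\|\psi-\phi_0\|_{L^p(\Omega)}<r_0$ and $|t-t_0|+\|\phi-\phi_0\|_{L^p(\Omega)}<r_0$. For $\beta:\Omega\to[0,1]$ put $J_t^{\beta(x)}v(t,x)=\frac{1}{\Gamma(\beta(x))}\int_0^t(t-s)^{\beta(x)-1}v(s,x)\,ds$ where $\beta(x)>0$ and $J_t^{\beta(x)}v(t,x)=v(t,x)$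 where $\beta(x)=0$ (an $L^p(\Omega)$-valued continuous function of $t$ is evaluated at $(t,x)$ through a jointly measurable representative). For $T>0$, a function $\varphi\in C([0,T];L^p(\Omega))$ is called a solution on $[0,T]\times\Omega$ of $$cD_t^{\alpha(x)}u(t,x)=Au(t,x)+f(t,u(t,x)),\qquad u(0,x)=u_0(x),\tag{P}$$ if $\varphi(0)=u_0$ and the Caputo derivative $cD_t^{\alpha(x)}\varphi=\frac{d}{dt}\,J_t^{1-\alpha(x)}\big[\varphi(t,x)-\varphi(0,x)\big]$ exists and equals $A\varphi(t)+f(t,\varphi(t))$ for every $t\in[0,T]$; that is, for every $t\in[0,T]$ the integral $J_t^{1-\alpha(x)}[\varphi(t,x)-\varphi(0,x)]$ exists for almost every $x\in\Omega$ and defines an element of $L^p(\Omega)$, and as an $L^p(\Omega)$-valued function of $t\in[0,T]$ it is differentiable in the norm of $L^p(\Omega)$ (one-sidedly at the endpoints) with that derivative. Let $\tau>0$ and let $\varphi\in C([0,\tau];L^p(\Omega))$ be a solution of (P) on $[0,\tau]\times\Omega$. Then for some $\tau^*>0$ there exists a unique continuation $\varphi^*$ of $\varphi$ to $[0,\tau+\tau^*]\times\Omega$: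 there is a solution $\varphi^*\in C([0,\tau+\tau^*];L^p(\Omega))$ of (P) on $[0,\tau+\tau^*]\times\Omega$ with $\varphi^*(t)=\varphi(t)$ for all $t\in[0,\tau]$, and every solution of (P) on $[0,\tau+\tau^*]\times\Omega$ coincides with $\varphi^*$ on $[0,\tau+\tau^*]$. -/

import Mathlib

open MeasureTheory Set
open scoped ENNReal

noncomputable section

namespace VarOrder

variable {E : Type*} [MeasurableSpace E]

/-- The Riemann-Liouville fractional integral of order `β x` in the time variable,
`(1 / Γ (β x)) ∫₀ᵗ (t - s) ^ (β x - 1) u(s, x) ds`, and `u(t, x)` where `β x = 0`. -/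
def rlIntegral (β : E → ℝ) (u : ℝ → E → ℝ) (t : ℝ) (x : E) : ℝ :=
  open Classical in
  if β x = 0 then u t x
  else (1 / Real.Gamma (β x)) * ∫ s in (0 : ℝ)..t, (t - s) ^ (β x - 1) * u s x

/-- The integral that defines `rlIntegral β u t x` exists. -/
def RLIntegralExists (β : E → ℝ) (u : ℝ → E → ℝ) (t : ℝ) (x : E) : Prop :=
  β x ≠ 0 → IntervalIntegrable (fun s => (t - s) ^ (β x - 1) * u s x) volume 0 t

/-- `u` is a function of the two variables `(t, x)` that represents the `L^p`-valued function `φ`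
on `I`: it is jointly measurable, and `u(t, ·)` is a representative of the class `φ t` for every
`t ∈ I`. Every continuous `φ` on an interval has one, and what follows does not depend on it. -/
def IsVersionOn {μ : Measure E} {p : ℝ≥0∞} (I : Set ℝ) (φ : ℝ → Lp ℝ p μ)
    (u : ℝ → E → ℝ) : Prop :=
  Measurable (Function.uncurry u) ∧ ∀ t ∈ I, φ t =ᵐ[μ] u t

variable {μ : Measure E} {p : ℝ≥0∞} [Fact (1 ≤ p)]

/-- On `I`, the Riemann-Liouville derivative of order `α x` of `φ` exists and is equal to `g`:
the fractional integral of order `1 - α x` of `φ` exists for every `t ∈ I` and almost every `x`,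
is an `L^p`-valued function `w` of `t ∈ I`, and `w` has the derivative `g t` (the limit of the
difference quotients is in `L^p`, one-sided at the endpoints of `I`) at every `t ∈ I`. -/
def HasRLDerivOn (I : Set ℝ) (α : E → ℝ) (φ g : ℝ → Lp ℝ p μ) : Prop :=
  ∃ u : ℝ → E → ℝ, IsVersionOn I φ u ∧
    (∀ t ∈ I, ∀ᵐ x ∂μ, RLIntegralExists (fun y => 1 - α y) u t x) ∧
    ∃ w : ℝ → Lp ℝ p μ,
      (∀ t ∈ I, ∀ᵐ x ∂μ, w t x = rlIntegral (fun y => 1 - α y) u t x) ∧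
      ∀ t ∈ I, HasDerivWithinAt w (g t) I t

/-- On `I`, the Caputo derivative of order `α x` of `φ` exists and is equal to `g`: it is the
Riemann-Liouville derivative of `φ(t, x) - φ(0, x)`. -/
def HasCaputoDerivOn (I : Set ℝ) (α : E → ℝ) (φ g : ℝ → Lp ℝ p μ) : Prop :=
  HasRLDerivOn I α (fun t => φ t - φ 0) g

/-- `φ ∈ C(I; L^p)` is a solution on `I` of the semilinear Cauchy problem
`cD_t^{α(x)} φ = A φ + f(t, φ)`, `φ(0) = u₀`. -/
structure IsSolutionOn (α : E → ℝ) (A : Lp ℝ p μ →L[ℝ] Lp ℝ p μ)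
    (f : ℝ → Lp ℝ p μ → Lp ℝ p μ) (u₀ : Lp ℝ p μ) (I : Set ℝ) (φ : ℝ → Lp ℝ p μ) : Prop where
  continuousOn : ContinuousOn φ I
  equation : HasCaputoDerivOn I α φ (fun t => A (φ t) + f t (φ t))
  initial : φ 0 = u₀

/-- `f : [0, ∞) × L^p → L^p` is locally Lipschitz in the second variable, uniformly with respect
to the first variable. -/
def LocLipschitzSnd (f : ℝ → Lp ℝ p μ → Lp ℝ p μ) : Prop :=
  ∀ t₀ : ℝ, 0 ≤ t₀ → ∀ φ₀ : Lp ℝ p μ, ∃ r₀ > 0, ∃ L₀ > 0,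
    ∀ (t : ℝ) (ψ φ : Lp ℝ p μ), 0 ≤ t →
      |t - t₀| + ‖ψ - φ₀‖ < r₀ → |t - t₀| + ‖φ - φ₀‖ < r₀ →
        ‖f t ψ - f t φ‖ ≤ L₀ * ‖ψ - φ‖

end VarOrder

end

/-! Inverting the fractional derivative turns (P) into the Volterra equation `φ t = u₀ + ∫₀ᵗ M (t -
s) (A (φ s) + f s (φ s)) ds`, where `M r` is multiplication by `r ^ (α x - 1) / Γ (α x)`. Since `α ≥
α₀ > 0`, the norm of `M r` is at most `C * (r ^ (α₀ - 1) + 1)`, which is locally integrable, and `A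
+ f` is locally Lipschitz. What remains is a Volterra problem in a Banach space.

Two inputs that agree up to `σ` have convolutions that differ at `t` by at most a constant times the
kernel mass on `[0, t - σ]`, which is small for `t` near `σ` (`norm_volterra_sub_le`,
`exists_small`). This gives a contraction among the functions that prolong `φ` beyond `τ` and stay
near `φ τ` (`exists_extension`), and it pushes the coincidence set of two solutions to the right
(`unique`).

The equivalence `isSolutionOn_iff` rests on Abel's identity `J^{1-α} J^α = J^1`, applied at almost
every fixed `x`. Jointly measurable versions and Fubini carry it to `L^p`-valued functions.
Conversely, if `J^{1-α} z = 0` then applying `J^α` gives `∫₀ᵗ z = 0` for all `t`, so a continuous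
`z` vanishes. -/

namespace VarOrder

/-! ### Volterra equations with weakly singular operator kernels in a Banach space. -/

section Volterra

open Filter Topology

variable {X : Type*} [NormedAddCommGroup X] [NormedSpace ℝ X]

/-- A norm-continuous family of operators on `(0, ∞)` with a locally integrable norm bound. -/
structure IsVolterraKernel (M : ℝ → X →L[ℝ] X) (κ : ℝ → ℝ) : Prop where
  continuousOn : ContinuousOn M (Ioi 0)
  bound : ∀ r, 0 < r → ‖M r‖ ≤ κ r
  intervalIntegrable : ∀ a b : ℝ, IntervalIntegrable κ volume a b

/-- The convolution `∫₀ᵗ M (t - s) (g s) ds`. -/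
noncomputable def volterra (M : ℝ → X →L[ℝ] X) (g : ℝ → X) (t : ℝ) : X :=
  ∫ s in (0 : ℝ)..t, M (t - s) (g s)

variable {M : ℝ → X →L[ℝ] X} {κ : ℝ → ℝ}

theorem volterra_congr {g h : ℝ → X} {t : ℝ} (ht : 0 ≤ t) (hgh : EqOn g h (Icc 0 t)) :
    volterra M g t = volterra M h t := by
  refine intervalIntegral.integral_congr fun s hs => ?_
  rw [uIcc_of_le ht] at hs
  simp only [hgh hs]

@[simp]
theorem volterra_zero_right (g : ℝ → X) : volterra M g 0 = 0 := by
  simp [volterra]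

theorem IsVolterraKernel.intervalIntegrable_apply (hM : IsVolterraKernel M κ) {g : ℝ → X}
    {a b t : ℝ} (hab : a ≤ b) (hbt : b ≤ t) (hg : ContinuousOn g (Icc a b)) :
    IntervalIntegrable (fun s => M (t - s) (g s)) volume a b := by
  obtain ⟨B, hB⟩ := isCompact_Icc.exists_bound_of_continuousOn hg
  have hκ : IntervalIntegrable (fun s => B * κ (t - s)) volume a b :=
    ((by simpa using (hM.intervalIntegrable (t - a) (t - b)).comp_sub_left t :
      IntervalIntegrable (fun s => κ (t - s)) volume a b)).const_mul B
  rw [intervalIntegrable_iff_integrableOn_Ioo_of_le hab] at hκ ⊢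
  refine Integrable.mono' hκ ?_ ?_
  · refine ContinuousOn.aestronglyMeasurable ?_ measurableSet_Ioo
    refine ContinuousOn.clm_apply ?_ (hg.mono Ioo_subset_Icc_self)
    exact hM.continuousOn.comp (by fun_prop) fun s hs => by
      simp only [mem_Ioi]; linarith [hs.2]
  · refine (ae_restrict_iff' measurableSet_Ioo).2 (Eventually.of_forall fun s hs => ?_)
    calc ‖M (t - s) (g s)‖ ≤ ‖M (t - s)‖ * ‖g s‖ := (M (t - s)).le_opNorm _
      _ ≤ κ (t - s) * B := by
        have h1 := hM.bound (t - s) (by linarith [hs.2])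
        exact mul_le_mul h1 (hB s (Ioo_subset_Icc_self hs)) (norm_nonneg _)
          ((norm_nonneg _).trans h1)
      _ = B * κ (t - s) := mul_comm _ _

/-- The substitution `r = t - s` moves the `t`-dependence from the singular kernel to the continuous
factor; dominated convergence then applies with a bound free of `t`. -/
theorem IsVolterraKernel.continuousOn_volterra (hM : IsVolterraKernel M κ) {g : ℝ → X} {T : ℝ}
    (hT : 0 ≤ T) (hg : ContinuousOn g (Icc 0 T)) : ContinuousOn (volterra M g) (Icc 0 T) := by
  set G : ℝ → X := IccExtend hT ((Icc 0 T).domRestrict g) with hG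
  have hGc : Continuous G := (continuousOn_iff_continuous_domRestrict.1 hg).Icc_extend'
  have hGg : EqOn G g (Icc 0 T) := fun s hs => by
    rw [hG, IccExtend_of_mem _ _ hs]; rfl
  obtain ⟨B, hB⟩ := isCompact_Icc.exists_bound_of_continuousOn hg
  have hGB : ∀ s, ‖G s‖ ≤ B := fun s => hB _ (projIcc 0 T hT s).2
  have heq : ∀ t ∈ Icc 0 T, (∫ r in (0 : ℝ)..t, M r (G (t - r))) = volterra M g t := by
    intro t ht
    rw [← volterra_congr ht.1 (hGg.mono (Icc_subset_Icc_right ht.2)), volterra]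
    have := intervalIntegral.integral_comp_sub_left (a := 0) (b := t)
      (fun r => M r (G (t - r))) t
    simpa using this.symm
  -- Nothing is known of `M r` for `r ≤ 0`, while the dominated-convergence window below starts at
  -- `-1`; hence the cutoff.
  set F : ℝ → ℝ → X := fun t => (Ioi (0 : ℝ)).indicator fun r => M r (G (t - r)) with hF
  have heq' : ∀ t ∈ Icc 0 T, volterra M g t = ∫ r in (0 : ℝ)..t, F t r := by
    intro t ht
    rw [← heq t ht, intervalIntegral.integral_of_le ht.1, intervalIntegral.integral_of_le ht.1]
    refine setIntegral_congr_fun measurableSet_Ioc fun r hr => ?_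
    simp only [hF, indicator_of_mem (show r ∈ Ioi (0 : ℝ) from hr.1)]
  refine ContinuousOn.congr (f := fun t => ∫ r in (0 : ℝ)..t, F t r) ?_ heq'
  intro t₀ ht₀
  apply ContinuousAt.continuousWithinAt
  have hB0 : 0 ≤ B := (norm_nonneg _).trans (hGB 0)
  -- The parameter enters both the integrand and the upper limit: continuity is proved in the two
  -- separately, then restricted to the diagonal.
  have key : ContinuousAt (fun p : ℝ × ℝ => ∫ r in (0 : ℝ)..p.2, F p.1 r) (t₀, t₀) := by
    refine intervalIntegral.continuousAt_parametric_primitive_of_dominated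
      (fun r => ‖κ r‖ * B) (-1) (t₀ + 1) ?_ ?_ ?_ ?_ ?_ ?_ ?_
    · intro t
      refine AEStronglyMeasurable.restrict ?_
      rw [hF, aestronglyMeasurable_indicator_iff measurableSet_Ioi]
      exact (ContinuousOn.clm_apply hM.continuousOn (by fun_prop)).aestronglyMeasurable
        measurableSet_Ioi
    · refine Eventually.of_forall fun t => Eventually.of_forall fun r => ?_
      by_cases hr : 0 < r
      · simp only [hF, indicator_of_mem (show r ∈ Ioi (0 : ℝ) from hr)]
        exact ((M r).le_opNorm _).trans (mul_le_mul ((hM.bound r hr).trans (Real.le_norm_self _))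
          (hGB _) (norm_nonneg _) (norm_nonneg _))
      · simp only [hF, indicator_of_notMem (show r ∉ Ioi (0 : ℝ) from hr), norm_zero]
        positivity
    · exact (hM.intervalIntegrable _ _).norm.mul_const B
    · refine Eventually.of_forall fun r => ?_
      by_cases hr : 0 < r
      · simp only [hF, indicator_of_mem (show r ∈ Ioi (0 : ℝ) from hr)]
        fun_prop
      · simp only [hF, indicator_of_notMem (show r ∉ Ioi (0 : ℝ) from hr)]
        fun_prop
    · constructor <;> linarith [ht₀.1]
    · constructor <;> linarith [ht₀.1]
    · simp
  exact key.comp (f := fun t : ℝ => (t, t)) (by fun_prop)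

/-- Stability of the convolution: only the interval where the two functions differ matters. -/
theorem IsVolterraKernel.norm_volterra_sub_le (hM : IsVolterraKernel M κ) {g h : ℝ → X}
    {σ t D : ℝ} (hσ : 0 ≤ σ) (hσt : σ ≤ t) (hg : ContinuousOn g (Icc 0 t))
    (hh : ContinuousOn h (Icc 0 t)) (heq : EqOn g h (Icc 0 σ))
    (hD : ∀ s ∈ Icc σ t, ‖g s - h s‖ ≤ D) :
    ‖volterra M g t - volterra M h t‖ ≤ D * ∫ r in (0 : ℝ)..(t - σ), κ r := by
  have ht := hσ.trans hσt
  have h1 : volterra M g t - volterra M h t = ∫ s in (0 : ℝ)..t, M (t - s) (g s - h s) := by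
    rw [volterra, volterra, ← intervalIntegral.integral_sub
      (hM.intervalIntegrable_apply ht le_rfl hg) (hM.intervalIntegrable_apply ht le_rfl hh)]
    simp
  have hi := hM.intervalIntegrable_apply ht le_rfl (hg.sub hh)
  have h2 : (∫ s in (0 : ℝ)..σ, M (t - s) (g s - h s)) = 0 := by
    rw [intervalIntegral.integral_congr (g := fun _ => (0 : X)), intervalIntegral.integral_zero]
    intro s hs
    rw [uIcc_of_le hσ] at hs
    simp [heq hs]
  have h3 : (∫ s in (0 : ℝ)..t, M (t - s) (g s - h s)) = ∫ s in σ..t, M (t - s) (g s - h s) := by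
    rw [← intervalIntegral.integral_add_adjacent_intervals (b := σ), h2, zero_add]
    · exact hi.mono_set (by rw [uIcc_of_le hσ, uIcc_of_le ht]; exact Icc_subset_Icc_right hσt)
    · exact hi.mono_set (by rw [uIcc_of_le hσt, uIcc_of_le ht]; exact Icc_subset_Icc_left hσ)
  have h4 : D * ∫ r in (0 : ℝ)..(t - σ), κ r = ∫ s in σ..t, κ (t - s) * D := by
    rw [intervalIntegral.integral_mul_const, intervalIntegral.integral_comp_sub_left, sub_self,
      mul_comm]
  rw [h1, h3, h4]
  refine intervalIntegral.norm_integral_le_of_norm_le hσt ?_ ?_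
  · filter_upwards [compl_mem_ae_iff.2 (measure_singleton t)] with s hs1 hs
    have hst : s < t := lt_of_le_of_ne hs.2 hs1
    have hb := hM.bound (t - s) (by linarith)
    exact ((M _).le_opNorm _).trans (mul_le_mul hb (hD s ⟨hs.1.le, hs.2⟩) (norm_nonneg _)
      ((norm_nonneg _).trans hb))
  · refine IntervalIntegrable.mul_const ?_ D
    simpa using (hM.intervalIntegrable (t - σ) (t - t)).comp_sub_left t

/-- The primitive of `κ` is continuous and vanishes at `0`. With `L` a Lipschitz constant, `1 / 2`
becomes the contraction factor. -/
theorem IsVolterraKernel.exists_small (hM : IsVolterraKernel M κ) (L : ℝ) :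
    ∃ δ > 0, ∀ h ∈ Icc 0 δ, L * ∫ r in (0 : ℝ)..h, κ r ≤ 1 / 2 := by
  have hc : Continuous fun h : ℝ => L * ∫ r in (0 : ℝ)..h, κ r :=
    continuous_const.mul (intervalIntegral.continuous_primitive hM.intervalIntegrable 0)
  have h0 : ∀ᶠ h in 𝓝 (0 : ℝ), L * (∫ r in (0 : ℝ)..h, κ r) < 1 / 2 :=
    hc.continuousAt.eventually_lt_const (by simp)
  obtain ⟨δ, hδ, hball⟩ := Metric.eventually_nhds_iff.1 h0
  refine ⟨δ / 2, by positivity, fun h hh => (hball ?_).le⟩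
  rw [Real.dist_eq, sub_zero, abs_of_nonneg hh.1]
  linarith [hh.2]

/-- `F : [0, ∞) × X → X` is locally Lipschitz in the second variable. -/
def LocLipschitz (F : ℝ → X → X) : Prop :=
  ∀ t₀ : ℝ, 0 ≤ t₀ → ∀ x₀ : X, ∃ r > 0, ∃ L > 0,
    ∀ (t : ℝ) (x y : X), 0 ≤ t → |t - t₀| + ‖x - x₀‖ < r → |t - t₀| + ‖y - x₀‖ < r →
      ‖F t x - F t y‖ ≤ L * ‖x - y‖

theorem continuousOn_comp_snd {Y : Type*} [TopologicalSpace Y] {F : ℝ → Y → Y}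
    (hF : ContinuousOn (Function.uncurry F) (Ici (0 : ℝ) ×ˢ univ)) {φ : ℝ → Y} {T : ℝ}
    (hφ : ContinuousOn φ (Icc 0 T)) : ContinuousOn (fun s => F s (φ s)) (Icc 0 T) :=
  hF.comp (continuousOn_id.prodMk hφ) fun _ hs => ⟨hs.1, mem_univ _⟩

/-- Uniqueness for the Volterra equation `φ = u₀ + M * F(·, φ)`. -/
theorem IsVolterraKernel.unique (hM : IsVolterraKernel M κ) {F : ℝ → X → X}
    (hF : ContinuousOn (Function.uncurry F) (Ici (0 : ℝ) ×ˢ univ)) (hL : LocLipschitz F)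
    {u₀ : X} {T : ℝ} {φ ψ : ℝ → X} (hφc : ContinuousOn φ (Icc 0 T))
    (hψc : ContinuousOn ψ (Icc 0 T))
    (hφ : ∀ t ∈ Icc 0 T, φ t = u₀ + volterra M (fun s => F s (φ s)) t)
    (hψ : ∀ t ∈ Icc 0 T, ψ t = u₀ + volterra M (fun s => F s (ψ s)) t) :
    EqOn φ ψ (Icc 0 T) := by
  rcases lt_or_ge T 0 with hT | hT
  · simp [Icc_eq_empty (not_le.2 hT)]
  have h0 : φ 0 = ψ 0 := by
    rw [hφ 0 ⟨le_rfl, hT⟩, hψ 0 ⟨le_rfl, hT⟩]; simp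
  set S : Set ℝ := {t | EqOn φ ψ (Icc 0 t)} with hS
  suffices h : Icc 0 T ⊆ S from h ⟨hT, le_rfl⟩
  -- Continuous induction: the set of times up to which the solutions agree is closed in `[0, T]`
  -- and can be prolonged to the right of each of its points.
  refine IsClosed.Icc_subset_of_forall_exists_gt ?_ ?_ ?_
  · refine isClosed_of_closure_subset fun t ht => ?_
    have htT : t ∈ Icc 0 T := by
      have := closure_mono inter_subset_right ht
      rwa [closure_Icc] at this
    refine ⟨?_, htT⟩
    rcases htT.1.eq_or_lt with rfl | htpos
    · intro s hs
      rw [le_antisymm hs.2 hs.1]; exact h0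
    have hlt : EqOn φ ψ (Ico 0 t) := fun s hs => by
      obtain ⟨r, hr1, hr2, -⟩ := mem_closure_iff.1 ht (Ioi s) isOpen_Ioi hs.2
      exact hr2 ⟨hs.1, le_of_lt hr1⟩
    exact hlt.of_subset_closure (hφc.mono (Icc_subset_Icc_right htT.2))
      (hψc.mono (Icc_subset_Icc_right htT.2)) Ico_subset_Icc_self
      (by rw [closure_Ico htpos.ne])
  · intro s hs
    rw [le_antisymm hs.2 hs.1]; exact h0
  · rintro x ⟨hxS, hx⟩ y hy
    obtain ⟨r, hr, L, hLpos, hlip⟩ := hL x hx.1 (φ x)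
    obtain ⟨δ₁, hδ₁, hsmall⟩ := hM.exists_small L
    have hxI : x ∈ Icc 0 T := Ico_subset_Icc_self hx
    have hnear : ∀ χ : ℝ → X, ContinuousOn χ (Icc 0 T) → χ x = φ x →
        ∃ δ > 0, ∀ t ∈ Icc 0 T, |t - x| < δ → ‖χ t - φ x‖ < r / 2 := by
      intro χ hχ hχx
      obtain ⟨δ, hδ, h⟩ := Metric.continuousWithinAt_iff.1 (hχ x hxI) (r / 2) (by positivity)
      refine ⟨δ, hδ, fun t ht htx => ?_⟩
      have := h ht (by rwa [Real.dist_eq])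
      rwa [dist_eq_norm, hχx] at this
    obtain ⟨δ₂, hδ₂, hφn⟩ := hnear φ hφc rfl
    obtain ⟨δ₃, hδ₃, hψn⟩ := hnear ψ hψc (hxS ⟨hx.1, le_rfl⟩).symm
    -- `δ₁` makes the kernel mass small; `r / 2` in time and, through `δ₂` and `δ₃`, `r / 2` in norm
    -- keep both solutions in the Lipschitz ball.
    obtain ⟨z, hxz, hz⟩ : ∃ z, x < z ∧ z < min (min T y) (x + min (min δ₁ (r / 2)) (min δ₂ δ₃)) :=
      exists_between (by
        have := hx.2; have : x < y := hy
        have : 0 < r / 2 := by positivity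
        simp only [lt_min_iff, lt_add_iff_pos_right]
        tauto)
    simp only [lt_min_iff, ← sub_lt_iff_lt_add'] at hz
    obtain ⟨⟨hzT, hzy⟩, ⟨hz1, hzr⟩, hz2, hz3⟩ := hz
    have hsub : Icc x z ⊆ Icc 0 T := Icc_subset_Icc hx.1 hzT.le
    refine ⟨z, ?_, hxz, hzy.le⟩
    -- At a maximum point the difference is bounded by half of itself, so it vanishes on all of `[x,
    -- z]`.
    obtain ⟨m, hm, hmax⟩ := isCompact_Icc.exists_isMaxOn (nonempty_Icc.2 hxz.le)
      ((hφc.sub hψc).norm.mono hsub)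
    have hmx : ∀ s ∈ Icc x z, ‖φ s - ψ s‖ ≤ ‖φ m - ψ m‖ := fun s hs => hmax hs
    have hmT := hsub hm
    have hle : ‖φ m - ψ m‖ ≤ (L * ‖φ m - ψ m‖) * ∫ r in (0 : ℝ)..(m - x), κ r := by
      have : φ m - ψ m = volterra M (fun s => F s (φ s)) m - volterra M (fun s => F s (ψ s)) m := by
        rw [hφ m hmT, hψ m hmT, add_sub_add_left_eq_sub]
      conv_lhs => rw [this]
      have hsm : Icc 0 m ⊆ Icc 0 T := Icc_subset_Icc_right hmT.2
      refine hM.norm_volterra_sub_le hx.1 hm.1 ((continuousOn_comp_snd hF hφc).mono hsm)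
        ((continuousOn_comp_snd hF hψc).mono hsm) (fun s hs => by simp only [hxS hs]) ?_
      intro s hs
      have hsz : s ∈ Icc x z := ⟨hs.1, hs.2.trans hm.2⟩
      have hsT := hsub hsz
      have habs : |s - x| = s - x := abs_of_nonneg (by linarith [hs.1])
      have h1 := hφn s hsT (by rw [habs]; linarith [hsz.2])
      have h2 := hψn s hsT (by rw [habs]; linarith [hsz.2])
      refine (hlip s _ _ hsT.1 ?_ ?_).trans (by gcongr; exact hmx s hsz)
      · rw [habs]; linarith [hsz.2]
      · rw [habs]; linarith [hsz.2]
    have hs := hsmall (m - x) ⟨by linarith [hm.1], by linarith [hm.2]⟩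
    have hzero : ‖φ m - ψ m‖ ≤ 0 := by
      nlinarith [mul_le_mul_of_nonneg_left hs (norm_nonneg (φ m - ψ m))]
    intro s hs
    rcases le_total s x with h | h
    · exact hxS ⟨hs.1, h⟩
    · have := (hmx s ⟨h, hs.2⟩).trans hzero
      exact sub_eq_zero.1 (norm_le_zero_iff.1 this)

/-- A solution of the Volterra equation `φ = u₀ + M * F(·, φ)` on `[0, τ]` extends to a larger
interval. -/
theorem IsVolterraKernel.exists_extension [CompleteSpace X] (hM : IsVolterraKernel M κ)
    {F : ℝ → X → X}
    (hF : ContinuousOn (Function.uncurry F) (Ici (0 : ℝ) ×ˢ univ)) (hL : LocLipschitz F)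
    {u₀ : X} {τ : ℝ} (hτ : 0 ≤ τ) {φ : ℝ → X} (hφc : ContinuousOn φ (Icc 0 τ))
    (hφ : ∀ t ∈ Icc 0 τ, φ t = u₀ + volterra M (fun s => F s (φ s)) t) :
    ∃ δ > 0, ∃ ψ : ℝ → X, ContinuousOn ψ (Icc 0 (τ + δ)) ∧ EqOn ψ φ (Icc 0 τ) ∧
      ∀ t ∈ Icc 0 (τ + δ), ψ t = u₀ + volterra M (fun s => F s (ψ s)) t := by
  have hτI : τ ∈ Icc 0 τ := ⟨hτ, le_rfl⟩
  obtain ⟨r, hr, L, hLpos, hlip⟩ := hL τ hτ (φ τ)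
  obtain ⟨δ₁, hδ₁, hsmall⟩ := hM.exists_small L
  -- The prolongation of `φ` by the constant `φ τ` serves as the centre of the ball for the
  -- fixed-point argument.
  set χ : ℝ → X := IccExtend hτ ((Icc 0 τ).domRestrict φ) with hχdef
  have hχc : Continuous χ := (continuousOn_iff_continuous_domRestrict.1 hφc).Icc_extend'
  have hχφ : EqOn χ φ (Icc 0 τ) := fun s hs => by
    rw [hχdef, IccExtend_of_mem _ _ hs]; rfl
  have hχτ : ∀ t, τ ≤ t → χ t = φ τ := fun t ht => by
    rw [hχdef, IccExtend_of_right_le _ _ ht]; rfl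
  -- the fixed point map, on functions
  set Φ : (ℝ → X) → ℝ → X := fun ψ t => u₀ + volterra M (fun s => F s (ψ s)) t with hΦ
  have hΦc : ∀ {T : ℝ} {ψ : ℝ → X}, 0 ≤ T → ContinuousOn ψ (Icc 0 T) →
      ContinuousOn (Φ ψ) (Icc 0 T) := fun hT hψ =>
    continuousOn_const.add (hM.continuousOn_volterra hT (continuousOn_comp_snd hF hψ))
  have hΦφ : ∀ {ψ : ℝ → X}, EqOn ψ φ (Icc 0 τ) → EqOn (Φ ψ) φ (Icc 0 τ) := by
    intro ψ h t ht
    rw [hφ t ht, hΦ]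
    simp only [add_right_inj]
    exact volterra_congr ht.1 fun s hs => by simp only [h ⟨hs.1, hs.2.trans ht.2⟩]
  obtain ⟨δ₂, hδ₂, hnear⟩ : ∃ δ > 0, ∀ t ∈ Icc 0 (τ + 1), |t - τ| < δ →
      ‖Φ χ t - φ τ‖ < r / 6 := by
    have hc : ContinuousWithinAt (Φ χ) (Icc 0 (τ + 1)) τ :=
      hΦc (by linarith) hχc.continuousOn τ ⟨hτ, by linarith⟩
    obtain ⟨δ, hδ, h⟩ := Metric.continuousWithinAt_iff.1 hc (r / 6) (by positivity)
    refine ⟨δ, hδ, fun t ht htx => ?_⟩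
    have := h ht (by rwa [Real.dist_eq])
    rwa [dist_eq_norm, hΦφ hχφ hτI] at this
  -- Time distance below `r / 3` plus norm distance at most `r / 3` stays within the Lipschitz
  -- radius `r`; `δ < 1` is the range of `hnear`.
  obtain ⟨δ, hδ, hδlt⟩ : ∃ δ, 0 < δ ∧ δ < min (min δ₁ δ₂) (min 1 (r / 3)) :=
    exists_between (by
      have : 0 < r / 3 := by positivity
      simp only [lt_min_iff]; simp [*])
  simp only [lt_min_iff] at hδlt
  obtain ⟨⟨hd1, hd2⟩, hd3, hdr⟩ := hδlt
  refine ⟨δ, hδ, ?_⟩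
  have hT : 0 ≤ τ + δ := by linarith
  -- the contraction estimate
  have hest : ∀ ψ₁ ψ₂ : ℝ → X, ContinuousOn ψ₁ (Icc 0 (τ + δ)) → ContinuousOn ψ₂ (Icc 0 (τ + δ)) →
      EqOn ψ₁ ψ₂ (Icc 0 τ) → (∀ t ∈ Icc τ (τ + δ), ‖ψ₁ t - φ τ‖ ≤ r / 3) →
      (∀ t ∈ Icc τ (τ + δ), ‖ψ₂ t - φ τ‖ ≤ r / 3) → ∀ D,
      (∀ t ∈ Icc τ (τ + δ), ‖ψ₁ t - ψ₂ t‖ ≤ D) → ∀ t ∈ Icc τ (τ + δ),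
      ‖Φ ψ₁ t - Φ ψ₂ t‖ ≤ D / 2 := by
    intro ψ₁ ψ₂ hc₁ hc₂ heq hb₁ hb₂ D hD t ht
    have hsm : Icc 0 t ⊆ Icc 0 (τ + δ) := Icc_subset_Icc_right ht.2
    have hD0 : 0 ≤ D := (norm_nonneg _).trans (hD t ht)
    have := hM.norm_volterra_sub_le (D := L * D) hτ ht.1 ((continuousOn_comp_snd hF hc₁).mono hsm)
      ((continuousOn_comp_snd hF hc₂).mono hsm) (fun s hs => by simp only [heq hs]) (by
        intro s hs
        have hs' : s ∈ Icc τ (τ + δ) := ⟨hs.1, hs.2.trans ht.2⟩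
        have habs : |s - τ| = s - τ := abs_of_nonneg (by linarith [hs.1])
        refine (hlip s _ _ (hτ.trans hs.1) ?_ ?_).trans (by gcongr; exact hD s hs')
        · rw [habs]; linarith [hs'.2, hb₁ s hs']
        · rw [habs]; linarith [hs'.2, hb₂ s hs'])
    have hs := hsmall (t - τ) ⟨by linarith [ht.1], by linarith [ht.2]⟩
    simp only [hΦ, add_sub_add_left_eq_sub]
    nlinarith [mul_le_mul_of_nonneg_left hs hD0]
  -- the complete metric space
  let E : C(Icc 0 (τ + δ), X) → ℝ → X := fun ψ => IccExtend hT ψ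
  have hEc : ∀ ψ, Continuous (E ψ) := fun ψ => ψ.continuous.Icc_extend'
  have hEv : ∀ ψ (t : Icc 0 (τ + δ)), E ψ t = ψ t := fun ψ t => IccExtend_val _ _ _
  let Ψ : C(Icc 0 (τ + δ), X) → C(Icc 0 (τ + δ), X) := fun ψ =>
    ⟨fun t => Φ (E ψ) t, continuousOn_iff_continuous_domRestrict.1
      (hΦc hT (hEc ψ).continuousOn)⟩
  -- Prescribing the values on `[0, τ]` makes the fixed point a continuation without any gluing.
  let s : Set C(Icc 0 (τ + δ), X) :=
    {ψ | ∀ t : Icc 0 (τ + δ), ((t : ℝ) ≤ τ → ψ t = φ t) ∧ (τ ≤ t → ‖ψ t - φ τ‖ ≤ r / 3)}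
  have hsE : ∀ ψ ∈ s, EqOn (E ψ) φ (Icc 0 τ) := fun ψ hψ t ht => by
    have := (hψ ⟨t, ht.1, by linarith [ht.2]⟩).1 ht.2
    rwa [← hEv] at this
  have hsB : ∀ ψ ∈ s, ∀ t ∈ Icc τ (τ + δ), ‖E ψ t - φ τ‖ ≤ r / 3 := fun ψ hψ t ht => by
    have := (hψ ⟨t, by linarith [ht.1], ht.2⟩).2 ht.1
    rwa [← hEv] at this
  have hclosed : IsClosed s := by
    simp only [s, ofPred_forall, ofPred_and]
    refine isClosed_iInter fun t => IsClosed.inter ?_ ?_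
    · exact isClosed_iInter fun _ => isClosed_eq (continuous_eval_const t)
        continuous_const
    · exact isClosed_iInter fun _ => isClosed_le
        ((continuous_eval_const t).sub continuous_const).norm continuous_const
  have hmaps : MapsTo Ψ s s := by
    intro ψ hψ t
    refine ⟨fun h => hΦφ (hsE ψ hψ) ⟨t.2.1, h⟩, fun h => ?_⟩
    have htI : (t : ℝ) ∈ Icc τ (τ + δ) := ⟨h, t.2.2⟩
    -- Invariance of the ball: `ψ` is within `r / 3` of `χ`, so its image is within `r / 6` of `Φ
    -- χ`, itself within `r / 6` of `φ τ`.
    have h1 := hest (E ψ) χ (hEc ψ).continuousOn hχc.continuousOn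
      ((hsE ψ hψ).trans hχφ.symm) (hsB ψ hψ)
      (fun t ht => by rw [hχτ t ht.1]; simp; positivity) (r / 3)
      (fun t ht => by rw [hχτ t ht.1]; exact hsB ψ hψ t ht) t htI
    have h2 := hnear t ⟨t.2.1, by linarith [t.2.2]⟩
      (by rw [abs_of_nonneg (by linarith)]; linarith [t.2.2])
    calc ‖Ψ ψ t - φ τ‖ = ‖(Φ (E ψ) t - Φ χ t) + (Φ χ t - φ τ)‖ := by
          rw [sub_add_sub_cancel]; rfl
      _ ≤ r / 3 / 2 + r / 6 := (norm_add_le _ _).trans (add_le_add h1 h2.le)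
      _ = r / 3 := by ring
  have hcontr : ContractingWith (1 / 2) (hmaps.restrict Ψ s s) := by
    refine ⟨by rw [← NNReal.coe_lt_coe]; norm_num, LipschitzWith.of_dist_le_mul ?_⟩
    rintro ⟨ψ₁, h₁⟩ ⟨ψ₂, h₂⟩
    change dist (Ψ ψ₁) (Ψ ψ₂) ≤ _ * dist ψ₁ ψ₂
    rw [ContinuousMap.dist_le (by positivity)]
    intro t
    have hpos : (0 : ℝ) ≤ ((1 / 2 : NNReal) : ℝ) * dist ψ₁ ψ₂ := by positivity
    rcases le_total (t : ℝ) τ with h | h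
    · rw [(hmaps h₁ t).1 h, (hmaps h₂ t).1 h, dist_self]; exact hpos
    · have := hest (E ψ₁) (E ψ₂) (hEc _).continuousOn (hEc _).continuousOn
        ((hsE _ h₁).trans (hsE _ h₂).symm) (hsB _ h₁) (hsB _ h₂) (dist ψ₁ ψ₂) (fun t ht => by
          have ht' : t ∈ Icc 0 (τ + δ) := ⟨by linarith [ht.1], ht.2⟩
          have := ContinuousMap.dist_apply_le_dist (f := ψ₁) (g := ψ₂) ⟨t, ht'⟩
          rwa [dist_eq_norm, ← hEv, ← hEv] at this) t ⟨h, t.2.2⟩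
      rw [dist_eq_norm]
      refine this.trans (le_of_eq ?_)
      push_cast; ring
  let ψ₀ : C(Icc 0 (τ + δ), X) := ⟨fun t => χ t, by fun_prop⟩
  have hψ₀ : ψ₀ ∈ s := fun t =>
    ⟨fun h => hχφ ⟨t.2.1, h⟩, fun h => by
      change ‖χ t - φ τ‖ ≤ _
      rw [hχτ t h]; simp; positivity⟩
  obtain ⟨ψ, hψs, hfix, -⟩ := hcontr.exists_fixedPoint' hclosed.isComplete hmaps hψ₀
    (edist_ne_top _ _)
  refine ⟨E ψ, (hEc ψ).continuousOn, hsE ψ hψs, fun t ht => ?_⟩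
  have := congrArg (fun q : C(Icc 0 (τ + δ), X) => q ⟨t, ht⟩) hfix.symm
  simp only [← hEv] at this
  exact this.trans (hEv (Ψ ψ) ⟨t, ht⟩)

end Volterra
end VarOrder

namespace VarOrder

/-! ### The Abel kernel and the composition of fractional integrals. -/

section AbelKernel

open Filter Topology

/-- A scaled Beta integral: the parameters `a` and `1 - a` add up to `1`, so the power of `c` is
trivial and `Γ 1 = 1` disappears. -/
theorem integral_rpow_mul_sub_rpow {a c : ℝ} (ha : a ∈ Ioo (0 : ℝ) 1) (hc : 0 < c) :
    ∫ x in (0 : ℝ)..c, x ^ (a - 1) * (c - x) ^ (1 - a - 1) = Real.Gamma a * Real.Gamma (1 - a) := by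
  have h1 := Complex.betaIntegral_scaled (a : ℂ) (1 - a : ℂ) hc
  have h2 := Complex.Gamma_mul_Gamma_eq_betaIntegral (s := (a : ℂ)) (t := (1 - a : ℂ))
    (by simpa using ha.1) (by simpa using ha.2)
  rw [add_sub_cancel, Complex.Gamma_one, one_mul] at h2
  rw [add_sub_cancel, sub_self, Complex.cpow_zero, one_mul, ← h2] at h1
  have h3 : ((∫ x in (0 : ℝ)..c, x ^ (a - 1) * (c - x) ^ (1 - a - 1) : ℝ) : ℂ) =
      ∫ x in (0 : ℝ)..c, (x : ℂ) ^ ((a : ℂ) - 1) * ((c : ℂ) - x) ^ ((1 : ℂ) - a - 1) := by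
    rw [← intervalIntegral.integral_ofReal]
    refine intervalIntegral.integral_congr fun x hx => ?_
    rw [uIcc_of_le hc.le] at hx
    rw [Complex.ofReal_mul, Complex.ofReal_cpow hx.1, Complex.ofReal_cpow (sub_nonneg.2 hx.2)]
    push_cast; rfl
  rw [h1] at h3
  have h4 : Complex.Gamma (1 - (a : ℂ)) = (Real.Gamma (1 - a) : ℂ) := by
    rw [← Complex.Gamma_ofReal]; push_cast; rfl
  rw [Complex.Gamma_ofReal, h4] at h3
  exact_mod_cast h3

theorem integral_abelKernel {a s t : ℝ} (ha : a ∈ Ioo (0 : ℝ) 1) (hst : s < t) :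
    ∫ r in s..t, (t - r) ^ (a - 1) * (r - s) ^ (1 - a - 1) =
      Real.Gamma a * Real.Gamma (1 - a) := by
  have ha' : 1 - a ∈ Ioo (0 : ℝ) 1 := ⟨by linarith [ha.2], by linarith [ha.1]⟩
  have h := integral_rpow_mul_sub_rpow ha' (sub_pos.2 hst)
  have h2 := intervalIntegral.integral_comp_sub_right (a := s) (b := t)
    (fun x => x ^ (1 - a - 1) * (t - s - x) ^ (1 - (1 - a) - 1)) s
  rw [sub_self, h] at h2
  rw [mul_comm (Real.Gamma a)]
  rw [sub_sub_cancel] at h2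
  rw [← h2]
  refine intervalIntegral.integral_congr fun x _ => ?_
  simp only [sub_sub_sub_cancel_right]
  ring

/-- The integral of a non-integrable function is `0` by convention, whereas this one has the
positive value `Γ a * Γ (1 - a)`. -/
theorem intervalIntegrable_abelKernel {a s t : ℝ} (ha : a ∈ Ioo (0 : ℝ) 1) (hst : s < t) :
    IntervalIntegrable (fun r => (t - r) ^ (a - 1) * (r - s) ^ (1 - a - 1)) volume s t := by
  by_contra h
  have h1 := integral_abelKernel ha hst
  rw [intervalIntegral.integral_undef h] at h1
  have := Real.Gamma_pos_of_pos ha.1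
  have := Real.Gamma_pos_of_pos (sub_pos.2 ha.2)
  have : 0 < Real.Gamma a * Real.Gamma (1 - a) := by positivity
  linarith

theorem setIntegral_indicator_Ioi {f : ℝ → ℝ} {s t : ℝ} (hs : s ∈ Ioc 0 t) :
    ∫ r in Ioc 0 t, (Ioi s).indicator f r = ∫ r in s..t, f r := by
  rw [setIntegral_indicator measurableSet_Ioi, intervalIntegral.integral_of_le hs.2]
  congr 2
  ext r
  simp only [mem_inter_iff, mem_Ioc, mem_Ioi]
  constructor
  · rintro ⟨⟨_, h2⟩, h3⟩; exact ⟨h3, h2⟩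
  · rintro ⟨h1, h2⟩; exact ⟨⟨hs.1.trans h1, h2⟩, h1⟩

/-- Abel's composition of the integrals of orders `1 - a` and `a`. -/
theorem abel_composition {a t : ℝ} (ha : a ∈ Ioo (0 : ℝ) 1) (ht : 0 ≤ t) {v : ℝ → ℝ}
    (hv : Measurable v) (hvi : IntervalIntegrable v volume 0 t) :
    IntervalIntegrable (fun r => (t - r) ^ (a - 1) * ∫ s in (0 : ℝ)..r, (r - s) ^ (1 - a - 1) * v s)
      volume 0 t ∧
    ∫ r in (0 : ℝ)..t, (t - r) ^ (a - 1) * ∫ s in (0 : ℝ)..r, (r - s) ^ (1 - a - 1) * v s =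
      (Real.Gamma a * Real.Gamma (1 - a)) * ∫ s in (0 : ℝ)..t, v s := by
  set B := Real.Gamma a * Real.Gamma (1 - a) with hB
  set ν : Measure ℝ := volume.restrict (Ioc 0 t) with hν
  -- The triangle `s < r` is written as an indicator on the square, ready for Fubini. The section `s
  -- = t` is degenerate and is discarded as a null set.
  set F : ℝ → ℝ → ℝ := fun r s =>
    (Ioi s).indicator (fun r => (t - r) ^ (a - 1) * (r - s) ^ (1 - a - 1)) r * v s with hF
  have hFm : Measurable (Function.uncurry F) := by
    have : Function.uncurry F = fun q : ℝ × ℝ => {q : ℝ × ℝ | q.2 < q.1}.indicator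
        (fun q => (t - q.1) ^ (a - 1) * (q.1 - q.2) ^ (1 - a - 1)) q * v q.2 := by
      ext ⟨r, s⟩
      simp only [Function.uncurry, hF, indicator, mem_Ioi, mem_ofPred_eq]
    rw [this]
    refine Measurable.mul (Measurable.indicator (by fun_prop) ?_) (by fun_prop)
    exact measurableSet_lt measurable_snd measurable_fst
  have hFint : ∀ s ∈ Ioc 0 t, s ≠ t → Integrable (fun r => F r s) ν := by
    intro s hs hst
    refine Integrable.mul_const ?_ _
    rw [integrable_indicator_iff measurableSet_Ioi, IntegrableOn, hν,
      Measure.restrict_restrict measurableSet_Ioi]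
    have := (intervalIntegrable_abelKernel ha (lt_of_le_of_ne hs.2 hst)).1
    exact this.mono_set fun r hr => ⟨hr.1, hr.2.2⟩
  have hFval : ∀ s ∈ Ioc 0 t, s ≠ t → ∫ r, F r s ∂ν = B * v s := by
    intro s hs hst
    rw [hF, integral_mul_const, hν, setIntegral_indicator_Ioi hs,
      integral_abelKernel ha (lt_of_le_of_ne hs.2 hst)]
  have hFnorm : ∀ s ∈ Ioc 0 t, s ≠ t → ∫ r, ‖F r s‖ ∂ν = B * ‖v s‖ := by
    intro s hs hst
    rw [hB, ← integral_abelKernel ha (lt_of_le_of_ne hs.2 hst), ← setIntegral_indicator_Ioi hs,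
      ← integral_mul_const]
    refine setIntegral_congr_fun measurableSet_Ioc fun r hr => ?_
    simp only [hF, norm_mul]
    congr 1
    rw [Real.norm_of_nonneg]
    refine indicator_apply_nonneg fun hrs => ?_
    exact mul_nonneg (Real.rpow_nonneg (sub_nonneg.2 hr.2) _)
      (Real.rpow_nonneg (sub_nonneg.2 (le_of_lt hrs)) _)
  have hae : ∀ᵐ s ∂ν, s ∈ Ioc 0 t ∧ s ≠ t := by
    filter_upwards [ae_restrict_mem measurableSet_Ioc,
      ae_restrict_of_ae (compl_mem_ae_iff.2 (measure_singleton t))] with s h1 h2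
    exact ⟨h1, h2⟩
  have hvν : Integrable v ν := (intervalIntegrable_iff_integrableOn_Ioc_of_le ht).1 hvi
  have hint : Integrable (Function.uncurry F) (ν.prod ν) := by
    rw [integrable_prod_iff' hFm.aestronglyMeasurable]
    constructor
    · filter_upwards [hae] with s hs
      exact hFint s hs.1 hs.2
    -- The kernel is nonnegative with constant mass `B`, so integrability on the product reduces to
    -- that of `v`.
    · refine (hvν.norm.const_mul B).congr ?_
      filter_upwards [hae] with s hs
      exact (hFnorm s hs.1 hs.2).symm
  have hin : ∀ r ∈ Ioc 0 t, ∫ s, F r s ∂ν =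
      (t - r) ^ (a - 1) * ∫ s in (0 : ℝ)..r, (r - s) ^ (1 - a - 1) * v s := by
    intro r hr
    rw [← intervalIntegral.integral_const_mul, intervalIntegral.integral_of_le hr.1.le]
    have h1 : ∀ s, F r s = (Iio r).indicator
        (fun s => (t - r) ^ (a - 1) * ((r - s) ^ (1 - a - 1) * v s)) s := by
      intro s
      by_cases hs : s < r
      · simp only [hF, indicator, mem_Ioi, mem_Iio, hs, if_true]; ring
      · simp only [hF, indicator, mem_Ioi, mem_Iio, hs, if_false]; ring
    simp_rw [h1]
    rw [hν, setIntegral_indicator measurableSet_Iio, integral_Ioc_eq_integral_Ioo]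
    congr 2
    ext s
    simp only [mem_inter_iff, mem_Ioc, mem_Iio, mem_Ioo]
    constructor
    · rintro ⟨⟨h2, _⟩, h3⟩; exact ⟨h2, h3⟩
    · rintro ⟨h2, h3⟩; exact ⟨⟨h2, h3.le.trans hr.2⟩, h3⟩
  constructor
  · rw [intervalIntegrable_iff_integrableOn_Ioc_of_le ht]
    exact hint.integral_prod_left.congr
      ((ae_restrict_iff' measurableSet_Ioc).2 (Eventually.of_forall hin))
  · rw [intervalIntegral.integral_of_le ht, ← setIntegral_congr_fun measurableSet_Ioc hin,
      intervalIntegral.integral_of_le ht, ← integral_const_mul]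
    change ∫ r, (∫ s, F r s ∂ν) ∂ν = _
    rw [integral_integral_swap hint]
    refine integral_congr_ae ?_
    filter_upwards [hae] with s hs
    exact hFval s hs.1 hs.2

end AbelKernel

/-! ### Fractional integrals at a fixed point of space. -/

section Pointwise

variable {E : Type*}

theorem rlIntegral_of_eq_zero {β : E → ℝ} {x : E} (h : β x = 0) (u : ℝ → E → ℝ) (t : ℝ) :
    rlIntegral β u t x = u t x := by
  simp [rlIntegral, h]

theorem rlIntegral_of_ne_zero {β : E → ℝ} {x : E} (h : β x ≠ 0) (u : ℝ → E → ℝ) (t : ℝ) :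
    rlIntegral β u t x =
      (1 / Real.Gamma (β x)) * ∫ s in (0 : ℝ)..t, (t - s) ^ (β x - 1) * u s x := by
  simp [rlIntegral, h]

theorem rlIntegral_congr_order {β β' : E → ℝ} {x : E} (h : β x = β' x) (u : ℝ → E → ℝ) (t : ℝ) :
    rlIntegral β u t x = rlIntegral β' u t x := by
  simp only [rlIntegral, h]

theorem rlIntegralExists_congr_order {β β' : E → ℝ} {x : E} (h : β x = β' x) {u : ℝ → E → ℝ}
    {t : ℝ} : RLIntegralExists β u t x ↔ RLIntegralExists β' u t x := by
  simp only [RLIntegralExists, h]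

/-- The fractional integrals of orders `β` and `1 - β` compose to the integral of order one. -/
theorem rlIntegral_rlIntegral {β : E → ℝ} {x : E} (hβ : β x ∈ Icc (0 : ℝ) 1) {v : ℝ → E → ℝ}
    (hv : Measurable fun s => v s x) {t : ℝ} (ht : 0 ≤ t)
    (hvi : IntervalIntegrable (fun s => v s x) volume 0 t) :
    RLIntegralExists (fun y => 1 - β y) (rlIntegral β v) t x ∧
      rlIntegral (fun y => 1 - β y) (rlIntegral β v) t x = ∫ s in (0 : ℝ)..t, v s x := by
  -- At the orders `0` and `1` one factor is the identity and the other the plain integral; only the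
  -- orders in between need Abel's identity.
  rcases hβ.1.eq_or_lt with h0 | h0
  · have hne : (fun y => 1 - β y) x ≠ 0 := by simp [← h0]
    refine ⟨fun _ => ?_, ?_⟩
    · simpa [rlIntegral_of_eq_zero h0.symm, ← h0] using hvi
    · rw [rlIntegral_of_ne_zero (β := fun y => 1 - β y) hne]
      simp [rlIntegral_of_eq_zero h0.symm, ← h0]
  rcases hβ.2.eq_or_lt with h1 | h1
  · have he : (fun y => 1 - β y) x = 0 := by simp [h1]
    refine ⟨fun h => absurd he h, ?_⟩
    rw [rlIntegral_of_eq_zero (β := fun y => 1 - β y) he, rlIntegral_of_ne_zero h0.ne']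
    simp [h1]
  · have hne : (fun y => 1 - β y) x ≠ 0 := (sub_pos.2 h1).ne'
    have ha : 1 - β x ∈ Ioo (0 : ℝ) 1 := ⟨by linarith, by linarith⟩
    have hb := abel_composition ha ht hv hvi
    simp only [sub_sub_cancel] at hb
    have hΓ : Real.Gamma (β x) ≠ 0 := (Real.Gamma_pos_of_pos h0).ne'
    have hΓ' : Real.Gamma (1 - β x) ≠ 0 := (Real.Gamma_pos_of_pos ha.1).ne'
    have heq : (fun s => (t - s) ^ (1 - β x - 1) * rlIntegral β v s x) = fun s =>
        (1 / Real.Gamma (β x)) * ((t - s) ^ (1 - β x - 1) *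
          ∫ r in (0 : ℝ)..s, (s - r) ^ (β x - 1) * v r x) := by
      ext s
      rw [rlIntegral_of_ne_zero h0.ne']
      ring
    refine ⟨fun _ => ?_, ?_⟩
    · simp only [heq]
      exact hb.1.const_mul _
    · rw [rlIntegral_of_ne_zero (β := fun y => 1 - β y) hne, heq, intervalIntegral.integral_const_mul, hb.2]
      field_simp

end Pointwise
end VarOrder

namespace VarOrder

open Filter Topology

/-! ### Jointly measurable versions and pointwise evaluation of Bochner integrals. -/

section Versions

variable {E : Type*} [MeasurableSpace E] {μ : Measure E} {p : ℝ≥0∞}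

/-- A geometric rate forces almost everywhere convergence of the whole sequence; convergence in
measure identifies the limit along a subsequence. -/
theorem ae_tendsto_of_norm_sub_le [Fact (1 ≤ p)] {g : ℕ → Lp ℝ p μ} {g₀ : Lp ℝ p μ}
    (h : ∀ n, ‖g n - g₀‖ ≤ (1 / 2) ^ n) :
    ∀ᵐ x ∂μ, Tendsto (fun n => g n x) atTop (𝓝 (g₀ x)) := by
  have hlim : Tendsto g atTop (𝓝 g₀) := by
    rw [tendsto_iff_norm_sub_tendsto_zero]
    exact squeeze_zero (fun _ => norm_nonneg _) h
      (tendsto_pow_atTop_nhds_zero_of_lt_one (by norm_num) (by norm_num))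
  obtain ⟨ns, hns, hsub⟩ := (tendstoInMeasure_of_tendsto_Lp hlim).exists_seq_tendsto_ae
  -- Two terms beyond `N` differ by at most `2 * (1 / 2) ^ N`; the factor `3` makes the bound
  -- strict.
  have hsum : Summable fun n : ℕ => (3 : ℝ) * (1 / 2) ^ n :=
    (summable_geometric_of_lt_one (by norm_num) (by norm_num)).mul_left 3
  have hconv : ∀ᵐ x ∂μ, ∃ l : ℝ, Tendsto (fun n => g n x) atTop (𝓝 l) := by
    refine Lp.ae_tendsto_of_cauchy_eLpNorm (p := p) (f := fun n => ⇑(g n))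
      (fun n => (Lp.stronglyMeasurable (g n)).aestronglyMeasurable) Fact.out
      (B := fun n => ENNReal.ofReal (3 * (1 / 2) ^ n)) hsum.tsum_ofReal_ne_top ?_
    intro N n m hn hm
    have h1 : eLpNorm (⇑(g n) - ⇑(g m)) p μ = ENNReal.ofReal ‖g n - g m‖ := by
      rw [← eLpNorm_congr_ae (Lp.coeFn_sub (g n) (g m)), Lp.norm_def,
        ENNReal.ofReal_toReal (Lp.eLpNorm_ne_top _)]
    rw [h1]
    refine (ENNReal.ofReal_lt_ofReal_iff (by positivity)).2 ?_
    have h2 : ∀ k, N ≤ k → ‖g k - g₀‖ ≤ (1 / 2) ^ N := fun k hk =>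
      (h k).trans (pow_le_pow_of_le_one (by norm_num) (by norm_num) hk)
    have h3 : ‖g n - g m‖ ≤ ‖g n - g₀‖ + ‖g m - g₀‖ := by
      rw [← sub_sub_sub_cancel_right (g n) (g m) g₀]; exact norm_sub_le _ _
    have : (0 : ℝ) < (1 / 2) ^ N := by positivity
    linarith [h2 n hn, h2 m hm]
  filter_upwards [hconv, hsub] with x ⟨l, hl⟩ hx
  rwa [← tendsto_nhds_unique (hl.comp hns.tendsto_atTop) hx]

/-- A continuous `L^p`-valued function on a compact interval has a jointly measurable version. -/
theorem exists_isVersionOn [Fact (1 ≤ p)] {T : ℝ} {g : ℝ → Lp ℝ p μ}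
    (hg : ContinuousOn g (Icc 0 T)) : ∃ G : ℝ → E → ℝ, IsVersionOn (Icc 0 T) g G := by
  have huc := (isCompact_Icc (a := (0 : ℝ)) (b := T)).uniformContinuousOn_of_continuous hg
  have hN : ∀ n : ℕ, ∃ N : ℝ, 0 < N ∧ ∀ s ∈ Icc 0 T, ∀ t ∈ Icc 0 T, |s - t| ≤ 1 / N →
      ‖g s - g t‖ ≤ (1 / 2) ^ n := by
    intro n
    obtain ⟨δ, hδ, h⟩ := Metric.uniformContinuousOn_iff.1 huc ((1 / 2) ^ n) (by positivity)
    refine ⟨2 / δ, by positivity, fun s hs t ht hst => ?_⟩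
    have := h s hs t ht (by rw [Real.dist_eq]; refine hst.trans_lt ?_; rw [one_div_div]; linarith)
    rw [dist_eq_norm] at this; exact this.le
  choose N hN0 hN using hN
  -- Sampling on a time grid uses countably many classes, hence is jointly measurable. Rounding down
  -- keeps the grid point in `[0, T]`.
  let Gn : ℕ → ℝ × E → ℝ := fun n q => g ((⌊q.1 * N n⌋ : ℝ) / N n) q.2
  have hGn : ∀ n, Measurable (Gn n) := by
    intro n
    have h1 : Measurable fun q : ℤ × E => g ((q.1 : ℝ) / N n) q.2 :=
      measurable_from_prod_countable_right fun k =>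
        (Lp.stronglyMeasurable (g ((k : ℝ) / N n))).measurable
    have h2 : Measurable fun q : ℝ × E => (⌊q.1 * N n⌋, q.2) := by fun_prop
    exact h1.comp h2
  -- The upper limit is measurable whether or not the sequence converges, and for each `t` it is the
  -- limit off a null set depending on `t`.
  refine ⟨fun t x => limsup (fun n => Gn n (t, x)) atTop, Measurable.limsup hGn, fun t ht => ?_⟩
  have hfl : ∀ n, ‖g ((⌊t * N n⌋ : ℝ) / N n) - g t‖ ≤ (1 / 2) ^ n := by
    intro n
    have h1 := Int.floor_le (t * N n)
    have h2 := Int.lt_floor_add_one (t * N n)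
    have h3 : (⌊t * N n⌋ : ℝ) / N n ≤ t := by rwa [div_le_iff₀ (hN0 n)]
    have h4 : t - 1 / N n ≤ (⌊t * N n⌋ : ℝ) / N n := by
      rw [le_div_iff₀ (hN0 n), sub_mul, one_div_mul_cancel (hN0 n).ne']; linarith
    have h5 : 0 ≤ (⌊t * N n⌋ : ℝ) := by
      exact_mod_cast Int.floor_nonneg.2 (mul_nonneg ht.1 (hN0 n).le)
    refine hN n _ ⟨div_nonneg h5 (hN0 n).le, h3.trans ht.2⟩ t ht ?_
    rw [abs_le]; constructor <;> linarith [one_div_pos.2 (hN0 n)]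
  filter_upwards [ae_tendsto_of_norm_sub_le hfl] with x hx
  exact hx.limsup_eq.symm

/-- Hölder's inequality on a set of finite measure. For `p = ∞` the conventions `∞.toReal = 0` and
`1 / 0 = 0` give the right exponent `1`. -/
theorem integrableOn_Lp [Fact (1 ≤ p)] {B : Set E} (hB : μ B ≠ ∞) (f : Lp ℝ p μ) :
    IntegrableOn f B μ ∧
      ∫ x in B, ‖f x‖ ∂μ ≤ (μ B ^ (1 - 1 / p.toReal)).toReal * ‖f‖ := by
  have hp : 1 ≤ p := Fact.out
  have hexp : 0 ≤ 1 - 1 / p.toReal := by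
    rcases eq_or_ne p ∞ with rfl | hp'
    · simp
    · have : 1 ≤ p.toReal := by simpa using ENNReal.toReal_mono hp' hp
      have := (div_le_one (by linarith)).2 this
      linarith
  have hfm : AEStronglyMeasurable f (μ.restrict B) :=
    (Lp.stronglyMeasurable f).aestronglyMeasurable
  have h1 : eLpNorm f 1 (μ.restrict B) ≤ eLpNorm f p μ * μ B ^ (1 - 1 / p.toReal) := by
    have := eLpNorm_le_eLpNorm_mul_rpow_measure_univ hp hfm
    simp only [ENNReal.toReal_one, div_one, Measure.restrict_apply_univ] at this
    exact this.trans (by gcongr; exact Measure.restrict_le_self)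
  have hne : μ B ^ (1 - 1 / p.toReal) ≠ ∞ := ENNReal.rpow_ne_top_of_nonneg hexp hB
  have hfin : eLpNorm f p μ * μ B ^ (1 - 1 / p.toReal) ≠ ∞ :=
    ENNReal.mul_ne_top (Lp.eLpNorm_ne_top f) hne
  refine ⟨memLp_one_iff_integrable.1 ⟨hfm, h1.trans_lt hfin.lt_top⟩, ?_⟩
  rw [integral_norm_eq_lintegral_enorm hfm, ← eLpNorm_one_eq_lintegral_enorm, Lp.norm_def,
    mul_comm, ← ENNReal.toReal_mul]
  exact ENNReal.toReal_mono hfin h1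

/-- The Bochner integral in `L^p` is computed pointwise. -/
theorem coeFn_integral_Lp [Fact (1 ≤ p)] [SigmaFinite μ] {S : Type*} [MeasurableSpace S]
    {ν : Measure S} [SFinite ν] {h : S → Lp ℝ p μ} (hh : Integrable h ν) {H : S → E → ℝ}
    (hH : Measurable (Function.uncurry H)) (hhH : ∀ᵐ s ∂ν, h s =ᵐ[μ] H s) :
    (∀ᵐ x ∂μ, Integrable (fun s => H s x) ν) ∧
      (∫ s, h s ∂ν : Lp ℝ p μ) =ᵐ[μ] fun x => ∫ s, H s x ∂ν := by
  have hint : ∀ B : Set E, μ B < ∞ → Integrable (Function.uncurry H) (ν.prod (μ.restrict B)) := by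
    intro B hB
    rw [integrable_prod_iff hH.aestronglyMeasurable]
    constructor
    · filter_upwards [hhH] with s hs
      exact (integrableOn_Lp hB.ne (h s)).1.congr (ae_restrict_of_ae hs)
    · refine Integrable.mono' (hh.norm.const_mul (μ B ^ (1 - 1 / p.toReal)).toReal) ?_ ?_
      · exact (hH.norm.stronglyMeasurable.integral_prod_right'
          (ν := μ.restrict B)).aestronglyMeasurable
      · filter_upwards [hhH] with s hs
        rw [Real.norm_of_nonneg (integral_nonneg fun _ => norm_nonneg _)]
        refine le_trans (le_of_eq ?_) (integrableOn_Lp hB.ne (h s)).2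
        refine integral_congr_ae ?_
        filter_upwards [ae_restrict_of_ae hs] with x hx
        simp [hx, Function.uncurry]
  refine ⟨ae_of_forall_measure_lt_top_ae_restrict _ fun B _ hB => (hint B hB).prod_left_ae, ?_⟩
  refine ae_eq_of_forall_setIntegral_eq_of_sigmaFinite
    (fun B _ hB => (integrableOn_Lp hB.ne _).1) (fun B _ hB => (hint B hB).integral_prod_right) ?_
  intro B _ hB
  -- Integration over `B` is a bounded functional, so it commutes with the Bochner integral. Such
  -- functionals determine the class almost everywhere, also for `p = ∞`.
  let l : Lp ℝ p μ →ₗ[ℝ] ℝ :=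
    { toFun := fun f => ∫ x in B, f x ∂μ
      map_add' := fun f g => by
        rw [← integral_add (integrableOn_Lp hB.ne f).1 (integrableOn_Lp hB.ne g).1]
        exact integral_congr_ae (ae_restrict_of_ae (Lp.coeFn_add f g))
      map_smul' := fun c f => by
        rw [RingHom.id_apply, smul_eq_mul, ← integral_const_mul]
        exact integral_congr_ae (ae_restrict_of_ae (Lp.coeFn_smul c f)) }
  let L : Lp ℝ p μ →L[ℝ] ℝ := l.mkContinuous _ fun f =>
    (norm_integral_le_integral_norm _).trans (integrableOn_Lp hB.ne f).2
  have hL : ∀ f, L f = ∫ x in B, f x ∂μ := fun _ => rfl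
  rw [← hL, ← L.integral_comp_comm hh, ← integral_integral_swap (hint B hB)]
  refine integral_congr_ae ?_
  filter_upwards [hhH] with s hs
  rw [hL]
  exact integral_congr_ae (ae_restrict_of_ae hs)

theorem measurable_intervalIntegral {P : Type*} [MeasurableSpace P] {F : P → ℝ → ℝ}
    (hF : Measurable (Function.uncurry F)) {a b : P → ℝ} (ha : Measurable a) (hb : Measurable b) :
    Measurable fun q => ∫ s in (a q)..(b q), F q s := by
  have key : ∀ {a b : P → ℝ}, Measurable a → Measurable b →
      Measurable fun q => ∫ s in Ioc (a q) (b q), F q s := by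
    intro a b ha hb
    have h1 : Measurable ({z : P × ℝ | z.2 ∈ Ioc (a z.1) (b z.1)}.indicator
        (Function.uncurry F)) :=
      hF.indicator ((measurableSet_lt (by fun_prop) measurable_snd).inter
        (measurableSet_le measurable_snd (by fun_prop)))
    have h2 := (h1.stronglyMeasurable.integral_prod_right' (ν := (volume : Measure ℝ))).measurable
    convert h2 using 2 with q
    rw [← integral_indicator measurableSet_Ioc]
    rfl
  exact (key ha hb).sub (key hb ha)

theorem continuousAt_Gamma {r : ℝ} (hr : 0 < r) : ContinuousAt Real.Gamma r :=
  (Real.differentiableAt_Gamma fun m =>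
    (lt_of_le_of_lt (neg_nonpos.2 m.cast_nonneg) hr).ne').continuousAt

theorem measurable_Gamma_comp {a : E → ℝ} (ha : Measurable a) (hpos : ∀ x, 0 < a x) :
    Measurable fun x => Real.Gamma (a x) := by
  have h1 : Measurable ((Ioi 0).piecewise Real.Gamma 0) :=
    ContinuousOn.measurable_piecewise
      (fun r hr => (continuousAt_Gamma hr).continuousWithinAt) continuousOn_const measurableSet_Ioi
  convert h1.comp ha using 2 with x
  exact (piecewise_eq_of_mem _ _ _ (show a x ∈ Ioi 0 from hpos x)).symm

/-- `Γ` is cut off to `(0, ∞)`, where it is continuous; the value at order `0` is never used. -/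
theorem measurable_rlIntegral {β : E → ℝ} (hβ : Measurable β) (hβ0 : ∀ x, 0 ≤ β x)
    {u : ℝ → E → ℝ}
    (hu : Measurable (Function.uncurry u)) : Measurable (Function.uncurry (rlIntegral β u)) := by
  classical
  have h1 : Measurable fun q : ℝ × E =>
      (1 / (Ioi 0).piecewise Real.Gamma 0 (β q.2)) *
        ∫ s in (0 : ℝ)..q.1, (q.1 - s) ^ (β q.2 - 1) * u s q.2 := by
    refine Measurable.mul ?_ (measurable_intervalIntegral ?_ measurable_const measurable_fst)
    · have : Measurable ((Ioi 0).piecewise Real.Gamma 0) :=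
        ContinuousOn.measurable_piecewise
          (fun r hr => (continuousAt_Gamma hr).continuousWithinAt)
          continuousOn_const measurableSet_Ioi
      fun_prop
    · have : Measurable fun z : (ℝ × E) × ℝ => u z.2 z.1.2 :=
        hu.comp (measurable_snd.prodMk (measurable_snd.comp measurable_fst))
      exact Measurable.mul (by fun_prop) this
  have h2 : Function.uncurry (rlIntegral β u) = fun q : ℝ × E => if β q.2 = 0 then u q.1 q.2 else
      (1 / (Ioi 0).piecewise Real.Gamma 0 (β q.2)) *
        ∫ s in (0 : ℝ)..q.1, (q.1 - s) ^ (β q.2 - 1) * u s q.2 := by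
    ext ⟨t, x⟩
    simp only [Function.uncurry]
    split_ifs with h
    · exact rlIntegral_of_eq_zero h u t
    · rw [rlIntegral_of_ne_zero h, piecewise_eq_of_mem _ _ _
        (show β x ∈ Ioi 0 from lt_of_le_of_ne (hβ0 x) (Ne.symm h))]
  rw [h2]
  exact Measurable.ite ((hβ.comp measurable_snd) (measurableSet_singleton 0)) hu h1

end Versions
end VarOrder

namespace VarOrder

open Filter Topology

/-! ### The multiplication operators as a Volterra kernel. -/

section Kernel

variable {E : Type*} [MeasurableSpace E] {μ : Measure E} {p : ℝ≥0∞} [Fact (1 ≤ p)]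

theorem exists_mulCLM {m : E → ℝ} (hm : Measurable m) {C : ℝ} (hC0 : 0 ≤ C)
    (hC : ∀ x, |m x| ≤ C) :
    ∃ L : Lp ℝ p μ →L[ℝ] Lp ℝ p μ, (∀ f, L f =ᵐ[μ] fun x => m x * f x) ∧ ‖L‖ ≤ C := by
  have hmem : ∀ f : Lp ℝ p μ, MemLp (fun x => m x * f x) p μ := fun f =>
    (Lp.memLp f).of_le_mul (c := C)
      (hm.aestronglyMeasurable.mul (Lp.stronglyMeasurable f).aestronglyMeasurable)
      (Eventually.of_forall fun x => by
        rw [norm_mul]; exact mul_le_mul_of_nonneg_right (hC x) (norm_nonneg _))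
  let l : Lp ℝ p μ →ₗ[ℝ] Lp ℝ p μ :=
    { toFun := fun f => (hmem f).toLp _
      map_add' := fun f g => by
        refine Lp.ext ?_
        filter_upwards [(hmem (f + g)).coeFn_toLp, (hmem f).coeFn_toLp, (hmem g).coeFn_toLp,
          Lp.coeFn_add f g, Lp.coeFn_add ((hmem f).toLp _) ((hmem g).toLp _)] with x h1 h2 h3 h4 h5
        rw [h1, h5, Pi.add_apply, h2, h3, h4, Pi.add_apply, mul_add]
      map_smul' := fun c f => by
        refine Lp.ext ?_
        filter_upwards [(hmem (c • f)).coeFn_toLp, (hmem f).coeFn_toLp,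
          Lp.coeFn_smul c f, Lp.coeFn_smul c ((hmem f).toLp _)] with x h1 h2 h3 h4
        rw [RingHom.id_apply, h1, h4, Pi.smul_apply, h2, h3, Pi.smul_apply, smul_eq_mul,
          smul_eq_mul, mul_left_comm] }
  have hl : ∀ f, l f =ᵐ[μ] fun x => m x * f x := fun f => (hmem f).coeFn_toLp
  refine ⟨l.mkContinuous C fun f => ?_, hl, LinearMap.mkContinuous_norm_le _ hC0 _⟩
  refine Lp.norm_le_mul_norm_of_ae_le_mul ?_
  filter_upwards [hl f] with x hx
  rw [hx, norm_mul]
  exact mul_le_mul_of_nonneg_right (hC x) (norm_nonneg _)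

/-- Factor out `r₀ ^ (a - 1)`: a power of `r₀ / r` with exponent in `[0, 1]` lies between `1` and
`r₀ / r`. Uniformity in `a` is what yields continuity in operator norm. -/
theorem abs_rpow_sub_rpow_le {a r r₀ : ℝ} (ha : a ∈ Icc (0 : ℝ) 1) (hr : 0 < r) (hr₀ : 0 < r₀) :
    |r ^ (a - 1) - r₀ ^ (a - 1)| ≤ r₀ ^ (a - 1) * |r₀ / r - 1| := by
  have hq : 0 < r₀ / r := by positivity
  have h1 : r ^ (a - 1) = r₀ ^ (a - 1) * (r₀ / r) ^ (1 - a) := by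
    rw [← neg_sub a 1, Real.rpow_neg hq.le, Real.div_rpow hr₀.le hr.le, inv_div,
      mul_div_cancel₀ _ (Real.rpow_pos_of_pos hr₀ _).ne']
  have h2 : |(r₀ / r) ^ (1 - a) - 1| ≤ |r₀ / r - 1| := by
    have e0 : 0 ≤ 1 - a := by linarith [ha.2]
    have e1 : 1 - a ≤ 1 := by linarith [ha.1]
    rcases le_total 1 (r₀ / r) with h | h
    · have i1 : 1 ≤ (r₀ / r) ^ (1 - a) := Real.one_le_rpow h e0
      have i2 : (r₀ / r) ^ (1 - a) ≤ r₀ / r := by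
        simpa using Real.rpow_le_rpow_of_exponent_le h e1
      rw [abs_of_nonneg (by linarith), abs_of_nonneg (by linarith)]
      linarith
    · have i1 : (r₀ / r) ^ (1 - a) ≤ 1 := Real.rpow_le_one hq.le h e0
      have i2 : r₀ / r ≤ (r₀ / r) ^ (1 - a) := by
        simpa using Real.rpow_le_rpow_of_exponent_ge hq h e1
      rw [abs_of_nonpos (by linarith), abs_of_nonpos (by linarith)]
      linarith
  rw [h1, ← mul_sub_one, abs_mul, abs_of_pos (Real.rpow_pos_of_pos hr₀ _)]
  exact mul_le_mul_of_nonneg_left h2 (Real.rpow_nonneg hr₀.le _)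

/-- The smallest order is the worst for `r ≤ 1`, and `1` suffices beyond; the bound is locally
integrable when `a₀ > 0`. -/
theorem rpow_sub_one_le {a₀ a r : ℝ} (ha : a ∈ Icc a₀ 1) (hr : 0 < r) :
    r ^ (a - 1) ≤ r ^ (a₀ - 1) + 1 := by
  rcases le_total r 1 with h | h
  · have := Real.rpow_le_rpow_of_exponent_ge hr h (show a₀ - 1 ≤ a - 1 by linarith [ha.1])
    linarith
  · have := Real.rpow_le_one_of_one_le_of_nonpos h (show a - 1 ≤ 0 by linarith [ha.2])
    have := Real.rpow_nonneg hr.le (a₀ - 1)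
    linarith

theorem exists_one_div_Gamma_le {a₀ : ℝ} (ha₀ : 0 < a₀) :
    ∃ C > 0, ∀ a ∈ Icc a₀ 1, 1 / Real.Gamma a ≤ C := by
  have hc : ContinuousOn (fun a => 1 / Real.Gamma a) (Icc a₀ 1) := fun a ha => by
    have hpos : 0 < a := ha₀.trans_le ha.1
    exact (continuousAt_const.div (continuousAt_Gamma hpos) (Real.Gamma_pos_of_pos hpos).ne').continuousWithinAt
  obtain ⟨C, hC⟩ := isCompact_Icc.exists_bound_of_continuousOn hc
  exact ⟨max C 1, by positivity, fun a ha =>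
    ((Real.le_norm_self _).trans (hC a ha)).trans (le_max_left _ _)⟩

/-- The multiplications by the kernels `r ^ (α x - 1) / Γ (α x)`. -/
theorem exists_isVolterraKernel {α : E → ℝ} (hα : Measurable α) {a₀ : ℝ} (ha₀ : a₀ ∈ Ioo (0 : ℝ) 1)
    (hα₀ : ∀ x, α x ∈ Icc a₀ 1) :
    ∃ (M : ℝ → Lp ℝ p μ →L[ℝ] Lp ℝ p μ) (κ : ℝ → ℝ), IsVolterraKernel M κ ∧
      ∀ r, 0 < r → ∀ f, M r f =ᵐ[μ] fun x =>
        1 / Real.Gamma (α x) * r ^ (α x - 1) * f x := by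
  obtain ⟨C, hC0, hC⟩ := exists_one_div_Gamma_le ha₀.1
  have hΓ : ∀ x, 0 < 1 / Real.Gamma (α x) := fun x =>
    one_div_pos.2 (Real.Gamma_pos_of_pos (ha₀.1.trans_le (hα₀ x).1))
  have hk0 : ∀ r, 0 < r → ∀ x, 0 ≤ 1 / Real.Gamma (α x) * r ^ (α x - 1) := fun r hr x =>
    mul_nonneg (hΓ x).le (Real.rpow_nonneg hr.le _)
  have hk : ∀ r, 0 < r → ∀ x, 1 / Real.Gamma (α x) * r ^ (α x - 1) ≤ C * (r ^ (a₀ - 1) + 1) :=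
    fun r hr x => mul_le_mul (hC _ (hα₀ x)) (rpow_sub_one_le (hα₀ x) hr)
      (Real.rpow_nonneg hr.le _) hC0.le
  have hΓm : Measurable fun x => 1 / Real.Gamma (α x) :=
    measurable_const.div (measurable_Gamma_comp hα fun x => ha₀.1.trans_le (hα₀ x).1)
  have hex : ∀ r : ℝ, ∃ L : Lp ℝ p μ →L[ℝ] Lp ℝ p μ, 0 < r →
      (∀ f, L f =ᵐ[μ] fun x => 1 / Real.Gamma (α x) * r ^ (α x - 1) * f x) ∧
        ‖L‖ ≤ C * (r ^ (a₀ - 1) + 1) := by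
    intro r
    rcases le_or_gt r 0 with hr | hr
    · exact ⟨0, fun h => absurd h hr.not_gt⟩
    · obtain ⟨L, hL⟩ := exists_mulCLM (p := p) (μ := μ)
        (m := fun x => 1 / Real.Gamma (α x) * r ^ (α x - 1)) (hΓm.mul (by fun_prop))
        (C := C * (r ^ (a₀ - 1) + 1)) (by have := Real.rpow_nonneg hr.le (a₀ - 1); positivity)
        (fun x => by rw [abs_of_nonneg (hk0 r hr x)]; exact hk r hr x)
      exact ⟨L, fun _ => hL⟩
  choose M hM using hex
  refine ⟨M, fun r => C * (r ^ (a₀ - 1) + 1), ⟨?_, fun r hr => (hM r hr).2, fun a b => ?_⟩,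
    fun r hr => (hM r hr).1⟩
  · intro r₀ hr₀
    have hr₀' : (0 : ℝ) < r₀ := hr₀
    have hlim : Tendsto (fun r => C * (r₀ ^ (a₀ - 1) + 1) * |r₀ / r - 1|) (𝓝[Ioi 0] r₀) (𝓝 0) := by
      have : ContinuousAt (fun r => C * (r₀ ^ (a₀ - 1) + 1) * |r₀ / r - 1|) r₀ :=
        continuousAt_const.mul
          ((continuousAt_const.div continuousAt_id hr₀'.ne').sub continuousAt_const).abs
      have h2 := this.tendsto
      simp only [div_self hr₀'.ne', sub_self, abs_zero, mul_zero] at h2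
      exact h2.mono_left nhdsWithin_le_nhds
    rw [ContinuousWithinAt, tendsto_iff_norm_sub_tendsto_zero]
    refine squeeze_zero' (Eventually.of_forall fun _ => norm_nonneg _) ?_ hlim
    filter_upwards [self_mem_nhdsWithin] with r hr
    have hr' : (0 : ℝ) < r := hr
    have hpos := Real.rpow_nonneg hr₀'.le (a₀ - 1)
    refine ContinuousLinearMap.opNorm_le_bound _ (by positivity) fun f => ?_
    rw [_root_.sub_apply]
    refine Lp.norm_le_mul_norm_of_ae_le_mul ?_
    filter_upwards [Lp.coeFn_sub (M r f) (M r₀ f), (hM r hr').1 f, (hM r₀ hr₀').1 f]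
      with x h1 h2 h3
    rw [h1, Pi.sub_apply, h2, h3, ← sub_mul, ← mul_sub, norm_mul, norm_mul,
      Real.norm_of_nonneg (hΓ x).le]
    refine mul_le_mul_of_nonneg_right ?_ (norm_nonneg _)
    have hx := abs_rpow_sub_rpow_le ⟨ha₀.1.le.trans (hα₀ x).1, (hα₀ x).2⟩ hr' hr₀'
    calc 1 / Real.Gamma (α x) * ‖r ^ (α x - 1) - r₀ ^ (α x - 1)‖
        ≤ 1 / Real.Gamma (α x) * (r₀ ^ (α x - 1) * |r₀ / r - 1|) :=
          mul_le_mul_of_nonneg_left hx (hΓ x).le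
      _ = (1 / Real.Gamma (α x) * r₀ ^ (α x - 1)) * |r₀ / r - 1| := by ring
      _ ≤ _ := mul_le_mul_of_nonneg_right (hk r₀ hr₀' x) (abs_nonneg _)
  · exact ((intervalIntegral.intervalIntegrable_rpow' (by linarith [ha₀.1])).add
      intervalIntegrable_const).const_mul C

end Kernel
end VarOrder

/-! ### Equivalence of the Caputo equation and the Volterra equation. -/

namespace VarOrder

open Filter Topology

theorem hasDerivWithinAt_integral {X : Type*} [NormedAddCommGroup X] [NormedSpace ℝ X]
    [CompleteSpace X] {g : ℝ → X} {T : ℝ} (hT : 0 ≤ T) (hg : ContinuousOn g (Icc 0 T)) {t : ℝ}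
    (ht : t ∈ Icc 0 T) :
    HasDerivWithinAt (fun t => ∫ s in (0 : ℝ)..t, g s) (g t) (Icc 0 T) t := by
  have hc : Continuous (IccExtend hT ((Icc 0 T).domRestrict g)) :=
    (continuousOn_iff_continuous_domRestrict.1 hg).Icc_extend'
  have heq : EqOn (IccExtend hT ((Icc 0 T).domRestrict g)) g (Icc 0 T) := fun s hs => by
    rw [IccExtend_of_mem _ _ hs]; rfl
  have hd := (hc.integral_hasStrictDerivAt 0 t).hasDerivAt.hasDerivWithinAt (s := Icc 0 T)
  rw [heq ht] at hd
  refine hd.congr_of_mem (fun s hs => ?_) ht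
  refine intervalIntegral.integral_congr fun r hr => ?_
  rw [uIcc_of_le hs.1] at hr
  exact (heq ⟨hr.1, hr.2.trans hs.2⟩).symm

section Equivalence

variable {E : Type*} [MeasurableSpace E] {μ : Measure E} {p : ℝ≥0∞} [Fact (1 ≤ p)]

theorem HasRLDerivOn.congr_order {I : Set ℝ} {α α' : E → ℝ} {φ g : ℝ → Lp ℝ p μ}
    (h : HasRLDerivOn I α φ g) (hα : α =ᵐ[μ] α') : HasRLDerivOn I α' φ g := by
  obtain ⟨u, hu, hex, w, hw, hd⟩ := h
  refine ⟨u, hu, fun t ht => ?_, w, fun t ht => ?_, hd⟩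
  · filter_upwards [hex t ht, hα] with x hx hxα
    exact (rlIntegralExists_congr_order (by simp only [hxα])).1 hx
  · filter_upwards [hw t ht, hα] with x hx hxα
    rw [hx]
    exact rlIntegral_congr_order (by simp only [hxα]) u t

theorem IsSolutionOn.congr_order {I : Set ℝ} {α α' : E → ℝ} {A : Lp ℝ p μ →L[ℝ] Lp ℝ p μ}
    {f : ℝ → Lp ℝ p μ → Lp ℝ p μ} {u₀ : Lp ℝ p μ} {φ : ℝ → Lp ℝ p μ}
    (h : IsSolutionOn α A f u₀ I φ) (hα : α =ᵐ[μ] α') : IsSolutionOn α' A f u₀ I φ :=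
  ⟨h.continuousOn, HasRLDerivOn.congr_order h.equation hα, h.initial⟩

theorem IsVersionOn.measurable_left {μ : Measure E} {p : ℝ≥0∞} {I : Set ℝ} {g : ℝ → Lp ℝ p μ}
    {G : ℝ → E → ℝ} (hG : IsVersionOn I g G) (x : E) : Measurable fun s => G s x :=
  hG.1.comp measurable_prodMk_right

variable [SigmaFinite μ] {T : ℝ} {g : ℝ → Lp ℝ p μ} {G : ℝ → E → ℝ}

theorem IsVersionOn.ae_intervalIntegrable (hT : 0 ≤ T) (hg : ContinuousOn g (Icc 0 T))
    (hG : IsVersionOn (Icc 0 T) g G) :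
    ∀ᵐ x ∂μ, IntervalIntegrable (fun s => G s x) volume 0 T := by
  have hi := (intervalIntegrable_iff_integrableOn_Ioc_of_le hT).1
    (hg.intervalIntegrable_of_Icc (μ := volume) hT)
  filter_upwards [(coeFn_integral_Lp hi hG.1 ((ae_restrict_iff' measurableSet_Ioc).2
    (Eventually.of_forall fun s hs => hG.2 s (Ioc_subset_Icc_self hs)))).1] with x hx
  exact (intervalIntegrable_iff_integrableOn_Ioc_of_le hT).2 hx

theorem IsVersionOn.coeFn_intervalIntegral (hg : ContinuousOn g (Icc 0 T))
    (hG : IsVersionOn (Icc 0 T) g G) {t : ℝ} (ht : t ∈ Icc 0 T) :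
    (∫ s in (0 : ℝ)..t, g s : Lp ℝ p μ) =ᵐ[μ] fun x => ∫ s in (0 : ℝ)..t, G s x := by
  have hsub : Icc 0 t ⊆ Icc 0 T := Icc_subset_Icc_right ht.2
  have hi := (intervalIntegrable_iff_integrableOn_Ioc_of_le ht.1).1
    ((hg.mono hsub).intervalIntegrable_of_Icc (μ := volume) ht.1)
  simp only [intervalIntegral.integral_of_le ht.1]
  exact (coeFn_integral_Lp hi hG.1 ((ae_restrict_iff' measurableSet_Ioc).2
    (Eventually.of_forall fun s hs => hG.2 s (hsub (Ioc_subset_Icc_self hs))))).2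

variable {α : E → ℝ} {a₀ : ℝ} {M : ℝ → Lp ℝ p μ →L[ℝ] Lp ℝ p μ} {κ : ℝ → ℝ}

/-- The Bochner integral is evaluated pointwise. The time `s = t`, where `M 0` is unspecified, is a
null set. -/
theorem IsVersionOn.coeFn_volterra (hα : Measurable α) (hα0 : ∀ x, 0 < α x)
    (hM : IsVolterraKernel M κ)
    (hMα : ∀ r, 0 < r → ∀ f, M r f =ᵐ[μ] fun x => 1 / Real.Gamma (α x) * r ^ (α x - 1) * f x)
    (hg : ContinuousOn g (Icc 0 T)) (hG : IsVersionOn (Icc 0 T) g G) {t : ℝ} (ht : t ∈ Icc 0 T) :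
    ⇑(volterra M g t) =ᵐ[μ] rlIntegral α G t := by
  have hsub : Icc 0 t ⊆ Icc 0 T := Icc_subset_Icc_right ht.2
  have hi := (intervalIntegrable_iff_integrableOn_Ioc_of_le ht.1).1
    (hM.intervalIntegrable_apply ht.1 le_rfl (hg.mono hsub))
  have hm : Measurable (Function.uncurry fun s x => (t - s) ^ (α x - 1) * G s x) :=
    Measurable.mul (by fun_prop) hG.1
  have hΓm : Measurable fun x => 1 / Real.Gamma (α x) := measurable_const.div (measurable_Gamma_comp hα hα0)
  have hm' : Measurable (Function.uncurry fun s x =>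
      1 / Real.Gamma (α x) * ((t - s) ^ (α x - 1) * G s x)) :=
    (hΓm.comp measurable_snd).mul hm
  have hcoe := (coeFn_integral_Lp hi hm' (by
    filter_upwards [ae_restrict_mem measurableSet_Ioc,
      ae_restrict_of_ae (compl_mem_ae_iff.2 (measure_singleton t))] with s hs hst
    have hlt : s < t := lt_of_le_of_ne hs.2 hst
    filter_upwards [hMα (t - s) (sub_pos.2 hlt) (g s), hG.2 s (hsub (Ioc_subset_Icc_self hs))]
      with x h1 h2
    rw [h1, h2, mul_assoc])).2
  rw [volterra, intervalIntegral.integral_of_le ht.1]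
  filter_upwards [hcoe] with x hx
  rw [hx, rlIntegral_of_ne_zero (hα0 x).ne', intervalIntegral.integral_of_le ht.1,
    integral_const_mul]

/-- The version `J^α G` of `φ - φ 0` satisfies `J^{1-α} J^α G = ∫ G`, so `w` is the primitive of the
continuous function `g`. -/
theorem hasCaputoDerivOn_of_eq_volterra (hT : 0 ≤ T) (hα : Measurable α)
    (hα0 : ∀ x, α x ∈ Ioc (0 : ℝ) 1)
    (hM : IsVolterraKernel M κ)
    (hMα : ∀ r, 0 < r → ∀ f, M r f =ᵐ[μ] fun x => 1 / Real.Gamma (α x) * r ^ (α x - 1) * f x)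
    (hg : ContinuousOn g (Icc 0 T)) {φ : ℝ → Lp ℝ p μ} {u₀ : Lp ℝ p μ}
    (hφ : ∀ t ∈ Icc 0 T, φ t = u₀ + volterra M g t) : HasCaputoDerivOn (Icc 0 T) α φ g := by
  obtain ⟨G, hG⟩ := exists_isVersionOn hg
  have hφ0 : φ 0 = u₀ := by rw [hφ 0 ⟨le_rfl, hT⟩, volterra_zero_right, add_zero]
  have hcomp : ∀ᵐ x ∂μ, ∀ t ∈ Icc 0 T,
      RLIntegralExists (fun y => 1 - α y) (rlIntegral α G) t x ∧
      rlIntegral (fun y => 1 - α y) (rlIntegral α G) t x = ∫ s in (0 : ℝ)..t, G s x := by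
    filter_upwards [hG.ae_intervalIntegrable hT hg] with x hx t ht
    refine rlIntegral_rlIntegral (Ioc_subset_Icc_self (hα0 x))
      (hG.measurable_left x) ht.1 (hx.mono_set ?_)
    rw [uIcc_of_le ht.1, uIcc_of_le hT]
    exact Icc_subset_Icc_right ht.2
  refine ⟨rlIntegral α G, ⟨measurable_rlIntegral hα (fun x => (hα0 x).1.le) hG.1,
    fun t ht => ?_⟩, fun t ht => ?_, fun t => ∫ s in (0 : ℝ)..t, g s, fun t ht => ?_,
    fun t ht => ?_⟩
  · simp only [hφ0, hφ t ht, add_sub_cancel_left]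
    exact hG.coeFn_volterra hα (fun x => (hα0 x).1) hM hMα hg ht
  · filter_upwards [hcomp] with x hx
    exact (hx t ht).1
  · filter_upwards [hcomp, hG.coeFn_intervalIntegral hg ht] with x hx h2
    rw [h2, (hx t ht).2]
  · exact hasDerivWithinAt_integral hT hg ht

theorem eq_volterra_of_hasCaputoDerivOn (hT : 0 < T) (hα : Measurable α)
    (hα0 : ∀ x, α x ∈ Ioc (0 : ℝ) 1)
    (hM : IsVolterraKernel M κ)
    (hMα : ∀ r, 0 < r → ∀ f, M r f =ᵐ[μ] fun x => 1 / Real.Gamma (α x) * r ^ (α x - 1) * f x)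
    (hg : ContinuousOn g (Icc 0 T)) {φ : ℝ → Lp ℝ p μ} (hφc : ContinuousOn φ (Icc 0 T))
    (hφ : HasCaputoDerivOn (Icc 0 T) α φ g) :
    ∀ t ∈ Icc 0 T, φ t = φ 0 + volterra M g t := by
  obtain ⟨G, hG⟩ := exists_isVersionOn hg
  obtain ⟨u, hu, hex, w, hw, hd⟩ := hφ
  have h0 : (0 : ℝ) ∈ Icc 0 T := ⟨le_rfl, hT.le⟩
  -- Where the order `1 - α x` is `0`, this uses the subtraction of `φ 0`; elsewhere the integral
  -- runs over a point.
  have hw0 : w 0 = 0 := by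
    refine Lp.ext ?_
    filter_upwards [hw 0 h0, hu.2 0 h0, Lp.coeFn_zero ℝ p μ] with x h1 h2 h3
    rw [h1, h3, Pi.zero_apply]
    by_cases hx : (fun y => 1 - α y) x = 0
    · rw [rlIntegral_of_eq_zero (β := fun y => 1 - α y) hx, ← h2, sub_self, h3, Pi.zero_apply]
    · rw [rlIntegral_of_ne_zero (β := fun y => 1 - α y) hx, intervalIntegral.integral_same, mul_zero]
  have hwint : ∀ t ∈ Icc 0 T, w t = ∫ s in (0 : ℝ)..t, g s := by
    intro t ht
    have hsub : Icc 0 t ⊆ Icc 0 T := Icc_subset_Icc_right ht.2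
    rw [intervalIntegral.integral_eq_sub_of_hasDerivAt_of_le ht.1
      (fun s hs => (hd s (hsub hs)).continuousWithinAt.mono hsub)
      (fun s hs => (hd s (hsub (Ioo_subset_Icc_self hs))).hasDerivAt
        (Icc_mem_nhds hs.1 (hs.2.trans_le ht.2)))
      ((hg.mono hsub).intervalIntegrable_of_Icc ht.1), hw0, sub_zero]
  have hvc : ContinuousOn (volterra M g) (Icc 0 T) := hM.continuousOn_volterra hT.le hg
  -- the difference of the two versions
  set z : ℝ → E → ℝ := fun t x => u t x - rlIntegral α G t x with hz
  have hzm : Measurable (Function.uncurry z) :=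
    hu.1.sub (measurable_rlIntegral hα (fun x => (hα0 x).1.le) hG.1)
  have hzver : IsVersionOn (Icc 0 T) (fun t => φ t - φ 0 - volterra M g t) z := by
    refine ⟨hzm, fun t ht => ?_⟩
    filter_upwards [Lp.coeFn_sub (φ t - φ 0) (volterra M g t), hu.2 t ht,
      hG.coeFn_volterra hα (fun x => (hα0 x).1) hM hMα hg ht] with x h1 h2 h3
    rw [h1, Pi.sub_apply, h2, h3]
  have hzc : ContinuousOn (fun t => φ t - φ 0 - volterra M g t) (Icc 0 T) :=
    (hφc.sub continuousOn_const).sub hvc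
  have hzi := hzver.ae_intervalIntegrable hT.le hzc
  have hGi := hG.ae_intervalIntegrable hT.le hg
  have hmono : ∀ {v : ℝ → ℝ} {t : ℝ}, t ∈ Icc 0 T → IntervalIntegrable v volume 0 T →
      IntervalIntegrable v volume 0 t := fun ht hv => hv.mono_set (by
    rw [uIcc_of_le ht.1, uIcc_of_le hT.le]; exact Icc_subset_Icc_right ht.2)
  -- the fractional integral of the difference vanishes
  have hz0 : ∀ t ∈ Icc 0 T, ∀ᵐ x ∂μ, rlIntegral (fun y => 1 - α y) z t x = 0 := by
    intro t ht
    filter_upwards [hex t ht, hw t ht, hG.coeFn_intervalIntegral hg ht, hGi] with x h1 h2 h3 h4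
    have hc := rlIntegral_rlIntegral (Ioc_subset_Icc_self (hα0 x))
      (hG.measurable_left x) ht.1 (hmono ht h4)
    have h5 : rlIntegral (fun y => 1 - α y) u t x =
        rlIntegral (fun y => 1 - α y) (rlIntegral α G) t x := by
      rw [← h2, hwint t ht, h3, hc.2]
    by_cases hx : (fun y => 1 - α y) x = 0
    · rw [rlIntegral_of_eq_zero (β := fun y => 1 - α y) hx] at h5 ⊢
      rw [rlIntegral_of_eq_zero (β := fun y => 1 - α y) hx] at h5
      rw [hz]; exact sub_eq_zero.2 h5
    · rw [rlIntegral_of_ne_zero (β := fun y => 1 - α y) hx] at h5 ⊢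
      rw [rlIntegral_of_ne_zero (β := fun y => 1 - α y) hx] at h5
      simp only [hz, mul_sub]
      -- Linearity needs both integrals to exist; for `u` this is the existence clause of the
      -- fractional derivative.
      rw [intervalIntegral.integral_sub (h1 hx) (hc.1 hx), mul_sub]
      exact sub_eq_zero.2 h5
  -- The exceptional null set in `hz0` depends on `t`; Fubini exchanges the quantifiers, at the
  -- price of losing a null set of times.
  have hz0' : ∀ᵐ x ∂μ, ∀ᵐ t ∂(volume.restrict (Icc 0 T)),
      rlIntegral (fun y => 1 - α y) z t x = 0 := by
    have hm := measurable_rlIntegral (β := fun y => 1 - α y) (by fun_prop)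
      (fun x => sub_nonneg.2 (hα0 x).2) hzm
    refine Measure.ae_ae_comm (p := fun t x => rlIntegral (fun y => 1 - α y) z t x = 0)
      (hm (measurableSet_singleton 0)) |>.1 ?_
    exact (ae_restrict_iff' measurableSet_Icc).2 (Eventually.of_forall hz0)
  -- hence so does its integral of order one
  have hzint : ∀ᵐ x ∂μ, ∀ t ∈ Icc 0 T, ∫ s in (0 : ℝ)..t, z s x = 0 := by
    filter_upwards [hzi, hz0'] with x h1 h2 t ht
    have hc := (rlIntegral_rlIntegral (β := fun y => 1 - α y) (x := x)
      ⟨sub_nonneg.2 (hα0 x).2, by linarith [(hα0 x).1]⟩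
      (hzver.measurable_left x) ht.1 (hmono ht h1)).2
    rw [← hc, rlIntegral_of_ne_zero (β := fun y => 1 - (1 - α y))
      (by simpa using (hα0 x).1.ne')]
    rw [intervalIntegral.integral_of_le ht.1, integral_eq_zero_of_ae, mul_zero]
    filter_upwards [ae_mono (Measure.restrict_mono
      (Ioc_subset_Icc_self.trans (Icc_subset_Icc_right ht.2)) le_rfl) h2] with s hs
    rw [hs, mul_zero, Pi.zero_apply]
  have hprim : ∀ t ∈ Icc 0 T, ∫ s in (0 : ℝ)..t, (φ s - φ 0 - volterra M g s) = 0 := by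
    intro t ht
    refine Lp.ext ?_
    filter_upwards [hzver.coeFn_intervalIntegral hzc ht, hzint, Lp.coeFn_zero ℝ p μ]
      with x h1 h2 h3
    rw [h1, h2 t ht, h3, Pi.zero_apply]
  -- and the continuous integrand is zero
  intro t ht
  have h1 := hasDerivWithinAt_integral hT.le hzc ht
  -- The primitive is constant on `[0, T]`, and derivatives within this interval are unique because
  -- `T > 0`.
  have h2 := (hasDerivWithinAt_const t (Icc 0 T) (0 : Lp ℝ p μ)).congr_of_mem hprim ht
  have := (uniqueDiffOn_Icc hT t ht).eq_deriv _ h1 h2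
  rwa [sub_sub, sub_eq_zero] at this

end Equivalence
end VarOrder

/-! ### Reduction of the Cauchy problem to the abstract equation. -/

namespace VarOrder

open Filter

section Solutions

variable {E : Type*} [MeasurableSpace E] {μ : Measure E} {p : ℝ≥0∞} [Fact (1 ≤ p)]

theorem LocLipschitzSnd.add_clm {f : ℝ → Lp ℝ p μ → Lp ℝ p μ} (hf : LocLipschitzSnd f)
    (A : Lp ℝ p μ →L[ℝ] Lp ℝ p μ) : LocLipschitz fun t ψ => A ψ + f t ψ := by
  intro t₀ ht₀ φ₀
  obtain ⟨r, hr, L, hL, h⟩ := hf t₀ ht₀ φ₀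
  refine ⟨r, hr, ‖A‖ + L, by positivity, fun t ψ φ ht hψ hφ => ?_⟩
  rw [add_sub_add_comm, ← map_sub, add_mul]
  exact (norm_add_le _ _).trans (add_le_add (A.le_opNorm _) (h t ψ φ ht hψ hφ))

theorem continuousOn_add_clm {f : ℝ → Lp ℝ p μ → Lp ℝ p μ}
    (hf : ContinuousOn (Function.uncurry f) (Ici (0 : ℝ) ×ˢ univ))
    (A : Lp ℝ p μ →L[ℝ] Lp ℝ p μ) :
    ContinuousOn (Function.uncurry fun t ψ => A ψ + f t ψ) (Ici (0 : ℝ) ×ˢ univ) :=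
  (A.continuous.comp continuous_snd).continuousOn.add hf

/-- Truncation makes the bounds hold everywhere, as the kernel construction requires; the change on
a null set does not affect being a solution. -/
theorem exists_measurable_order {α : E → ℝ} (hα : AEMeasurable α μ) {a₀ : ℝ} (ha₀ : a₀ ≤ 1)
    (hmem : ∀ᵐ x ∂μ, α x ∈ Icc a₀ 1) :
    ∃ β : E → ℝ, Measurable β ∧ (∀ x, β x ∈ Icc a₀ 1) ∧ α =ᵐ[μ] β := by
  refine ⟨fun x => max a₀ (min 1 (hα.mk α x)),
    measurable_const.max (measurable_const.min hα.measurable_mk),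
    fun x => ⟨le_max_left _ _, max_le ha₀ (min_le_left _ _)⟩, ?_⟩
  filter_upwards [hα.ae_eq_mk, hmem] with x h1 h2
  rw [← h1, min_eq_right h2.2, max_eq_right h2.1]

/-- The Cauchy problem is equivalent to a Volterra equation. -/
theorem isSolutionOn_iff [SigmaFinite μ] {T : ℝ} (hT : 0 < T) {α : E → ℝ} (hα : Measurable α)
    (hα0 : ∀ x, α x ∈ Ioc (0 : ℝ) 1) {M : ℝ → Lp ℝ p μ →L[ℝ] Lp ℝ p μ} {κ : ℝ → ℝ}
    (hM : IsVolterraKernel M κ)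
    (hMα : ∀ r, 0 < r → ∀ f, M r f =ᵐ[μ] fun x => 1 / Real.Gamma (α x) * r ^ (α x - 1) * f x)
    {A : Lp ℝ p μ →L[ℝ] Lp ℝ p μ} {f : ℝ → Lp ℝ p μ → Lp ℝ p μ}
    (hf : ContinuousOn (Function.uncurry f) (Ici (0 : ℝ) ×ˢ univ)) {u₀ : Lp ℝ p μ}
    {φ : ℝ → Lp ℝ p μ} :
    IsSolutionOn α A f u₀ (Icc 0 T) φ ↔ ContinuousOn φ (Icc 0 T) ∧
      ∀ t ∈ Icc 0 T, φ t = u₀ + volterra M (fun s => A (φ s) + f s (φ s)) t := by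
  constructor
  · rintro ⟨hc, he, rfl⟩
    exact ⟨hc, eq_volterra_of_hasCaputoDerivOn hT hα hα0 hM hMα
      (continuousOn_comp_snd (continuousOn_add_clm hf A) hc) hc he⟩
  · rintro ⟨hc, he⟩
    refine ⟨hc, hasCaputoDerivOn_of_eq_volterra hT.le hα hα0 hM hMα
      (continuousOn_comp_snd (continuousOn_add_clm hf A) hc) he, ?_⟩
    rw [he 0 ⟨le_rfl, hT.le⟩, volterra_zero_right, add_zero]

end Solutions
end VarOrder

theorem lemma4p1 {n : ℕ} (Ω : Set (EuclideanSpace ℝ (Fin n))) (hΩ : IsOpen Ω)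
    (p : ℝ≥0∞) [Fact (1 ≤ p)]
    (α : EuclideanSpace ℝ (Fin n) → ℝ) (hα_meas : AEMeasurable α (volume.restrict Ω))
    (α₀ : ℝ) (hα₀ : α₀ ∈ Ioo (0 : ℝ) 1)
    (hα : ∀ᵐ x ∂(volume.restrict Ω), α x ∈ Icc α₀ 1)
    (A : Lp ℝ p (volume.restrict Ω) →L[ℝ] Lp ℝ p (volume.restrict Ω))
    (f : ℝ → Lp ℝ p (volume.restrict Ω) → Lp ℝ p (volume.restrict Ω))
    (hf_cont : ContinuousOn (Function.uncurry f) (Ici (0 : ℝ) ×ˢ univ))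
    (hf_lip : VarOrder.LocLipschitzSnd f)
    (u₀ : Lp ℝ p (volume.restrict Ω)) (τ : ℝ) (hτ : 0 < τ)
    (φ : ℝ → Lp ℝ p (volume.restrict Ω))
    (hφ : VarOrder.IsSolutionOn α A f u₀ (Icc 0 τ) φ) :
    ∃ τ' : ℝ, 0 < τ' ∧ ∃ φ' : ℝ → Lp ℝ p (volume.restrict Ω),
      VarOrder.IsSolutionOn α A f u₀ (Icc 0 (τ + τ')) φ' ∧
      EqOn φ' φ (Icc 0 τ) ∧
      ∀ ψ : ℝ → Lp ℝ p (volume.restrict Ω),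
        VarOrder.IsSolutionOn α A f u₀ (Icc 0 (τ + τ')) ψ →
          EqOn ψ φ' (Icc 0 (τ + τ')) := by
  obtain ⟨β, hβm, hβ, hαβ⟩ := VarOrder.exists_measurable_order hα_meas hα₀.2.le hα
  obtain ⟨M, κ, hM, hMβ⟩ :=
    VarOrder.exists_isVolterraKernel (p := p) (μ := volume.restrict Ω) hβm hα₀ hβ
  -- The kernel does not depend on the interval, so solutions on `[0, τ]` and on `[0, τ + δ]`
  -- satisfy one and the same Volterra equation.
  have hiff : ∀ {T : ℝ} {ψ : ℝ → Lp ℝ p (volume.restrict Ω)}, 0 < T →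
      (VarOrder.IsSolutionOn α A f u₀ (Icc 0 T) ψ ↔ ContinuousOn ψ (Icc 0 T) ∧
        ∀ t ∈ Icc 0 T, ψ t = u₀ + VarOrder.volterra M (fun s => A (ψ s) + f s (ψ s)) t) :=
    fun hT => Iff.trans ⟨fun h => h.congr_order hαβ, fun h => h.congr_order hαβ.symm⟩
      (VarOrder.isSolutionOn_iff hT hβm (fun x => ⟨hα₀.1.trans_le (hβ x).1, (hβ x).2⟩) hM hMβ
        hf_cont)
  have hF := VarOrder.continuousOn_add_clm hf_cont A
  have hL := hf_lip.add_clm A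
  obtain ⟨hφc, hφe⟩ := (hiff hτ).1 hφ
  obtain ⟨δ, hδ, φ', hc, heq, he⟩ := hM.exists_extension hF hL hτ.le hφc hφe
  refine ⟨δ, hδ, φ', (hiff (by linarith)).2 ⟨hc, he⟩, heq, fun ψ hψ => ?_⟩
  obtain ⟨hψc, hψe⟩ := (hiff (by linarith)).1 hψ
  exact hM.unique hF hL hψc hc hψe he
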